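/- **Setting.** Let $n,m,K,d$ be integers with $m\ge 1$ and $1\le K\le n$. For $i\le n$, $j\le m$ let $f_{ij}:\mathbb R^d\to\mathbb R$ be convex and $L_{ij}$-smooth (differentiable with $L_{ij}$-Lipschitz gradient), $L_{ij}>0$; let $\sigma>0$ and let $\theta_\star$ minimize $\sum_{i=1}^n\big[\sum_{j=1}^m f_{ij}(\theta)+\frac\sigma2\|\theta\|^2\big]$. Put $\tilde\sigma=\frac{n\sigma}{n+K}$, $\kappa_s=\max_i\big(1+\sum_j L_{ij}/\tilde\sigma\big)$, $\alpha=\frac{2K}{\tilde\sigma\kappa_s}$. Let $p_{\rm comp}\in(0,1)$, $p_{\rm comm}=1-p_{\rm comp}$, $p_{ik}=\frac{p_{\rm comm}}{nK}$, $p_{ij}=\frac{p_{\rm comp}}{n}\,\frac{1+L_{ij}/\tilde\sigma}{\sum_{j'}(1+L_{ij'}/\tilde\sigma)}$, and $$\eta=\min\Big(\frac{\tilde\sigma p_{\rm comm}}{2nK},\ \frac{p_{\rm comp}}{\alpha n(m-1+\kappa_s)}\Big),\qquad \rho_{\rm comm}=\frac{nK\eta}{p_{\rm comm}\tilde\sigma},\qquad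 \rho_{ij}=\frac{\alpha\eta}{p_{ij}} .$$ **Algorithm (TVR).** Start from arbitrary $z_0^{(i,j)}$, with $\theta_0^{(i)}=-\frac1{\tilde\sigma}\sum_j\nabla f_{ij}(z_0^{(i,j)})$ and $\theta_0^{{\rm token},k}=0$. Steps are drawn independently. With probability $p_{ik}$, for each node $i$ and token $k$, the step is a communication (token jump): $\theta^{{\rm token},k}_{t+1}=\theta^{{\rm token},k}_t-\rho_{\rm comm}(\theta^{{\rm token},k}_t-\theta^{(i)}_t)$ and $\theta^{(i)}_{t+1}=\theta^{(i)}_t+\rho_{\rm comm}(\theta^{{\rm token},k}_t-\theta^{(i)}_t)$. With probability $p_{ij}$, for each node $i$ and index $j$, it is a computation: $z^{(i,j)}_{t+1}=(1-\rho_{ij})z^{(i,j)}_t+\rho_{ij}\theta_t^{(i)}$ and $\theta_{t+1}^{(i)}=\theta_t^{(i)}-\frac1{\tilde\sigma}\big(\nabla f_{ij}(z^{(i,j)}_{t+1})-\nabla f_{ij}(z^{(i,j)}_{t})\big)$. All other variables are unchanged. (If $L_{ij}$ does not depend on $j$, then $j$ is uniform and $\rho_{ij}=mn\alpha\eta/p_{\rm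 comp}$.) Write $\|\theta_t-\theta_\star\|^2=\sum_i\|\theta_t^{(i)}-\theta_\star\|^2+\sum_k\|\theta_t^{{\rm token},k}-\theta_\star\|^2$. **Lyapunov function.** Let $A$ be the weighted incidence matrix (acting as $A\otimes I_d$) of the graph whose nodes are the computation nodes $(i,j)$, the center nodes $i$ and the tokens $k$, with edges $i$–$k$ of weight $1$ and edges $(i,j)$–$i$, oriented from $(i,j)$ to $i$, of weight $\mu_{ij}=\sqrt{\alpha L_{ij}}$. Let $x,y$ be the variables on the two kinds of edges, and let $A_{\rm comm}$ be the restriction of $A$ to centers, tokens and the edges between them. The dual problem is to minimize $$D(x,y)=\frac1{2\tilde\sigma}\sum_{v\ \text{center or token}}\|(A(x,y))^{(v)}\|^2+\sum_{i,j}f_{ij}^*(\mu_{ij}y^{(ij)}),$$ and the reference function is $h(x,y)=\frac12\|x\|^2_{A_{\rm comm}^\dagger A_{\rm comm}}+\sum_{i,j}\frac{L_{ij}}{\mu_{ij}^2}f^*_{ij}(\mu_{ij}y^{(ij)})$. Let $w_0=(x_0,y_0)$ with $x_0=0$, $\mu_{ij}y_0^{(ij)}=\nabla f_{ij}(z_0^{(i,j)})$,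 let $w_\star$ be a minimizer of $D$, let $R_p=\min_e p_e/(A^\dagger A)_{ee}$ over all edges $e$, and $$\mathcal L_0=D_h(w_\star,w_0)+\frac{\eta}{R_p}\,[D(w_0)-D(w_\star)],\qquad C_0=\frac{2R_p}{\tilde\sigma\,\eta}\,\mathcal L_0,$$ where $D_h(w,w_0)=h(w)-h(w_0)-\langle g,w-w_0\rangle$ and $g$ is the (sub)gradient of $h$ at $w_0$ with components $0$ on $i$–$k$ edges and $\frac{L_{ij}}{\mu_{ij}}z_0^{(i,j)}$ on $(i,j)$–$i$ edges. **Theorem.** The dual problem has a minimizer, and for every minimizer $w_\star$: 1. For all $t\ge0$, $\displaystyle \mathbb E\,\|\theta_t-\theta_\star\|^2\le\Big(1-\frac{\eta K}{\tilde\sigma\kappa_s}\Big)^tC_0 .$ 2. Let $\varepsilon>0$ and $\Lambda=1+\max(0,\log(C_0/\varepsilon))$. If $p_{\rm comp}=\big(1+\frac{\kappa_s}{m-1+\kappa_s}\big)^{-1}$, there is $T$ such that $\mathbb E\|\theta_t-\theta_\star\|^2\le\varepsilon$ for all $t\ge T$, while the expected number $T_{\rm comp}$ of gradient steps performed by each node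 and the expected total number $T_{\rm comm}$ of token jumps during the first $T$ steps satisfy $T_{\rm comp}\le 2(m+\kappa_s)\Lambda$ and $T_{\rm comm}\le 2n\kappa_s\Lambda$. 3. If $p_{\rm comp}=p_{\rm comm}=\frac12$, the same holds with $T_{\rm comp}\le2(m+\kappa_s)\Lambda$ and $T_{\rm comm}\le 2n(m-1+\kappa_s)\Lambda$ (so $2n\kappa_s\Lambda$ if $m=1$). -/

import Mathlib

open MeasureTheory ProbabilityTheory

noncomputable section

namespace TVR

/-- The space `ℝ^d` of the model parameter. -/
abbrev Vec (d : ℕ) := EuclideanSpace ℝ (Fin d)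

/-- Data of a finite-sum problem over `n` nodes with `m` functions per node, to be solved with
`K` tokens: the local functions `f i j`, their smoothness constants `L i j`, and the
regularization `σ`. -/
structure Problem (d n m K : ℕ) where
  f : Fin n → Fin m → Vec d → ℝ
  L : Fin n → Fin m → ℝ
  σ : ℝ

/-- Edges of the conceptual graph: `inl (i, k)` is the communication edge between node `i` and
token `k`, and `inr (i, j)` is the computation edge between node `i` and its `j`-th function.
One step of the algorithm draws one edge. -/
abbrev Edge (n m K : ℕ) := (Fin n × Fin K) ⊕ (Fin n × Fin m)

/-- Nodes of the conceptual graph: `inl (i, j)` is the computation node holding `f i j`,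
`inr (inl i)` is the communication (center) node `i`, and `inr (inr k)` is the token `k`. -/
abbrev GNode (n m K : ℕ) := (Fin n × Fin m) ⊕ (Fin n ⊕ Fin K)

/-- `M†M`, the orthogonal projection onto the row space `(ker M)ᗮ` of `M`, as a matrix. -/
def pinvProj {ι κ : Type*} [Fintype ι] [Fintype κ] [DecidableEq κ] (M : Matrix ι κ ℝ) :
    Matrix κ κ ℝ :=
  fun a b => (LinearMap.ker (Matrix.toEuclideanLin M))ᗮ.starProjection (EuclideanSpace.single b 1) a

/-- Action of a real matrix on a family of vectors of `ℝ^d` (that is, of `M ⊗ I_d`). -/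
def act {ι κ : Type*} [Fintype κ] {d : ℕ} (M : Matrix ι κ ℝ) (w : κ → Vec d) : ι → Vec d :=
  fun v => ∑ e, M v e • w e

/-- The convex conjugate `φ*(l) = sup_θ ⟪l, θ⟫ - φ θ`, with values in the extended reals. -/
def conj {d : ℕ} (φ : Vec d → ℝ) (l : Vec d) : EReal :=
  ⨆ θ : Vec d, ((inner ℝ l θ - φ θ : ℝ) : EReal)

/-- The Bregman divergence `h(w) - h(w₀) - ⟪g, w - w₀⟫`, where `g` is the (sub)gradient of `h`
at `w₀`; it is `∇h(w₀)` where `h` is differentiable. -/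
def bregman {κ : Type*} [Fintype κ] {d : ℕ} (h : (κ → Vec d) → ℝ) (g w w₀ : κ → Vec d) : ℝ :=
  h w - h w₀ - ∑ e, inner ℝ (g e) (w e - w₀ e)

/-- The variables of the algorithm: the local parameters `θ^(i)`, the token parameters
`θ^(token,k)` and the virtual parameters `z^(i,j)`. -/
structure State (d n m K : ℕ) where
  node : Fin n → Vec d
  token : Fin K → Vec d
  z : Fin n → Fin m → Vec d

/-- `‖θ - θ⋆‖²` for the stacked vector `θ` of all node and token parameters. -/
def State.sqDist {d n m K : ℕ} (s : State d n m K) (θs : Vec d) : ℝ :=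
  ∑ i, ‖s.node i - θs‖ ^ 2 + ∑ k, ‖s.token k - θs‖ ^ 2

namespace Problem

variable {d n m K : ℕ} (Q : Problem d n m K) (pcomp : ℝ)

/-- The global objective `∑ᵢ [fᵢ(θ) + σ/2 ‖θ‖²]` with `fᵢ = ∑ⱼ f i j`. -/
def objective (θ : Vec d) : ℝ :=
  ∑ i, ((∑ j, Q.f i j θ) + Q.σ / 2 * ‖θ‖ ^ 2)

/-- `σ̃ = n σ / (n + K)`. -/
def sigmaT : ℝ := n * Q.σ / (n + K)

/-- `κ_s = max_i (1 + ∑ⱼ L i j / σ̃)`. -/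
def kappaS : ℝ := ⨆ i, (1 + ∑ j, Q.L i j / Q.sigmaT)

/-- `α = 2 K / (σ̃ κ_s)`. -/
def alpha : ℝ := 2 * K / (Q.sigmaT * Q.kappaS)

/-- The value of `p_comp` that balances the two step-size constraints,
`(1 + κ_s / (m - 1 + κ_s))⁻¹`. -/
def pBalanced : ℝ := (1 + Q.kappaS / (m - 1 + Q.kappaS))⁻¹

/-- Probability of drawing an edge in one step. With probability `1 - p_comp` the step is a
communication, with `(i, k)` uniform. Otherwise `i` is uniform and, given `i`, the index `j` has
probability proportional to `1 + L i j / σ̃` (uniform if `L i j` does not depend on `j`). -/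
def prob : Edge n m K → ℝ
  | .inl _ => (1 - pcomp) / (n * K)
  | .inr (i, j) =>
      pcomp / n * ((1 + Q.L i j / Q.sigmaT) / ∑ j', (1 + Q.L i j' / Q.sigmaT))

/-- The step-size `η = min (σ̃ p_comm / (2 n K)) (p_comp / (α n (m - 1 + κ_s)))`. -/
def eta : ℝ :=
  min (Q.sigmaT * (1 - pcomp) / (2 * n * K)) (pcomp / (Q.alpha * n * (m - 1 + Q.kappaS)))

/-- `ρ_comm = n K η / (p_comm σ̃)`. -/
def rhoComm : ℝ := n * K * Q.eta pcomp / ((1 - pcomp) * Q.sigmaT)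

/-- `ρ_comp = α η / p_ij`, which is `m n α η / p_comp` if `j` is drawn uniformly. -/
def rhoComp (i : Fin n) (j : Fin m) : ℝ :=
  Q.alpha * Q.eta pcomp / Q.prob pcomp (.inr (i, j))

/-- Initialization of the algorithm at arbitrary virtual parameters `z₀`. -/
def init (z₀ : Fin n → Fin m → Vec d) : State d n m K where
  node i := -((1 / Q.sigmaT) • ∑ j, gradient (Q.f i j) (z₀ i j))
  token _ := 0
  z := z₀

/-- One step of the algorithm, along the drawn edge. -/
def step (e : Edge n m K) (s : State d n m K) : State d n m K :=
  match e with
  | .inl (i, k) =>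
      { node := Function.update s.node i
          (s.node i + Q.rhoComm pcomp • (s.token k - s.node i))
        token := Function.update s.token k
          (s.token k - Q.rhoComm pcomp • (s.token k - s.node i))
        z := s.z }
  | .inr (i, j) =>
      let z' : Vec d :=
        (1 - Q.rhoComp pcomp i j) • s.z i j + Q.rhoComp pcomp i j • s.node i
      { node := Function.update s.node i
          (s.node i - (1 / Q.sigmaT) • (gradient (Q.f i j) z' - gradient (Q.f i j) (s.z i j)))
        token := s.token
        z := Function.update s.z i (Function.update (s.z i) j z') }

/-- The iterates of the algorithm along a sequence of drawn edges. -/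
def iterate (z₀ : Fin n → Fin m → Vec d) (ξ : ℕ → Edge n m K) : ℕ → State d n m K
  | 0 => Q.init z₀
  | t + 1 => Q.step pcomp (ξ t) (iterate z₀ ξ t)

/-- Edge weights of the conceptual graph: `1` on communication edges, and `μ_ij` with
`μ_ij² = α L i j` on computation edges. -/
def weight : Edge n m K → ℝ
  | .inl _ => 1
  | .inr (i, j) => Real.sqrt (Q.alpha * Q.L i j)

/-- First endpoint of an (oriented) edge. -/
def head : Edge n m K → GNode n m K
  | .inl (i, _) => .inr (.inl i)
  | .inr (i, j) => .inl (i, j)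

/-- Second endpoint of an (oriented) edge. -/
def tail : Edge n m K → GNode n m K
  | .inl (_, k) => .inr (.inr k)
  | .inr (i, _) => .inr (.inl i)

/-- The weighted incidence matrix `A` of the conceptual graph. -/
def incidence : Matrix (GNode n m K) (Edge n m K) ℝ :=
  fun v e => Q.weight e * ((if v = head e then 1 else 0) - (if v = tail e then 1 else 0))

/-- `A_comm`, the restriction of `A` to the communication part of the conceptual graph (center
nodes, tokens, and the edges between them). -/
def incidenceComm : Matrix (Fin n ⊕ Fin K) (Fin n × Fin K) ℝ :=
  Q.incidence.submatrix Sum.inr Sum.inl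

/-- `R_e = (A†A)_ee`. -/
def R (e : Edge n m K) : ℝ := pinvProj Q.incidence e e

/-- `R_p = min_e p_e / R_e`. -/
def Rp : ℝ := ⨅ e : Edge n m K, Q.prob pcomp e / Q.R e

/-- The quadratic part of the dual problem: the sum, over the center nodes and the tokens, of the
conjugates of `σ̃/2 ‖·‖²` at the components of `A w`. -/
def dualQuad (w : Edge n m K → Vec d) : ℝ :=
  1 / (2 * Q.sigmaT) * ∑ v : Fin n ⊕ Fin K, ‖act Q.incidence w (.inr v)‖ ^ 2

/-- The dual objective, at `w = (x, y)`. -/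
def dualObj (w : Edge n m K → Vec d) : EReal :=
  (Q.dualQuad w : EReal) + ∑ i, ∑ j, conj (Q.f i j) (act Q.incidence w (.inl (i, j)))

/-- `w` is a solution of the dual problem. -/
def IsDualOpt (w : Edge n m K → Vec d) : Prop := ∀ w', Q.dualObj w ≤ Q.dualObj w'

/-- The reference function `h(x, y) = h_x(x) + h_y(y)`, with
`h_x(x) = 1/2 ‖x‖²` in the seminorm of `A_comm†A_comm`, and
`h_y(y) = ∑ (L i j / μ_ij²) (f i j)*(μ_ij y_ij)`. -/
def refFun (w : Edge n m K → Vec d) : ℝ :=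
  1 / 2 * ∑ e, inner ℝ (w (.inl e)) (act (pinvProj Q.incidenceComm) (fun e' => w (.inl e')) e)
    + ∑ i, ∑ j, Q.L i j / Q.weight (.inr (i, j)) ^ 2 *
        (conj (Q.f i j) (Q.weight (.inr (i, j)) • w (.inr (i, j)))).toReal

/-- The dual point of the initialization: `x₀ = 0` and `μ_ij y_ij = ∇(f i j)(z₀ i j)`. -/
def dualInit (z₀ : Fin n → Fin m → Vec d) : Edge n m K → Vec d
  | .inl _ => 0
  | .inr (i, j) => (Q.weight (.inr (i, j)))⁻¹ • gradient (Q.f i j) (z₀ i j)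

/-- The (sub)gradient of `refFun` at `dualInit z₀`: since `z₀ i j` is the (sub)gradient of
`(f i j)*` at `∇(f i j)(z₀ i j)`, it is `(L i j / μ_ij) z₀ i j` on computation edges, and it is
zero on communication edges, where `x₀ = 0`. -/
def refGradInit (z₀ : Fin n → Fin m → Vec d) : Edge n m K → Vec d
  | .inl _ => 0
  | .inr (i, j) => (Q.L i j / Q.weight (.inr (i, j))) • z₀ i j

/-- The Bregman coordinate descent Lyapunov function of the dual problem at initialization,
`ℒ₀ = D_h(w⋆, w₀) + η / R_p (dual(w₀) - dual(w⋆))`. -/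
def lyapunovInit (z₀ : Fin n → Fin m → Vec d) (ws : Edge n m K → Vec d) : ℝ :=
  bregman Q.refFun (Q.refGradInit z₀) ws (Q.dualInit z₀)
    + Q.eta pcomp / Q.Rp pcomp *
      ((Q.dualObj (Q.dualInit z₀)).toReal - (Q.dualObj ws).toReal)

/-- `C₀ = 2 R_p / (σ̃ η) ℒ₀`. -/
def C0 (z₀ : Fin n → Fin m → Vec d) (ws : Edge n m K → Vec d) : ℝ :=
  2 * Q.Rp pcomp / (Q.sigmaT * Q.eta pcomp) * Q.lyapunovInit pcomp z₀ ws

end Problem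

/-- Number of gradient steps performed by node `i` during the first `T` steps. -/
def compCount {n m K : ℕ} (ξ : ℕ → Edge n m K) (i : Fin n) (T : ℕ) : ℕ :=
  ((Finset.range T).filter (fun s => ∃ j, ξ s = .inr (i, j))).card

/-- Total number of token jumps during the first `T` steps. -/
def commCount {n m K : ℕ} (ξ : ℕ → Edge n m K) (T : ℕ) : ℕ :=
  ((Finset.range T).filter (fun s => ∃ e, ξ s = .inl e)).card

end TVR

end

/-! TVR is Bregman coordinate descent on the dual problem, one edge of the graph being one
coordinate. The analysis does not carry the dual variables along: every quantity is written as a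
function of the primal state. The residual of `A_comm x` against the optimum is `nodeRes` at centers
and `tokenRes` at tokens, `D_h(w⋆, w)` becomes `refDiv`, and the dual suboptimality becomes
`dualGap`, which contains `σ̃/2 ‖θ - θ⋆‖²`. The Lyapunov function is `refDiv + (η / R_p) dualGap`.

One step along an edge `e`, weighted by `p_e`, changes it by `η` times a linear term plus a
second-order error. That error sits in `refDiv` and is paid for by the decrease of `dualGap`: on
communication edges because `ρ_comm ≤ 1/2` and `R_p ≤ p_e / R_e`, on computation edges by
cocoercivity and `ρ_ij (1 + L_ij / σ̃) ≤ 1`. The linear terms of all edges add up to `-η` times `σ̃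
‖θ - θ⋆‖²` plus the symmetrized Bregman divergences of the `f_ij` (`sum_prob_mul_lyapunov_le`).
Relative strong convexity (`rate_mul_lyapunov_le`), from a weighted Cauchy-Schwarz inequality and
cocoercivity, bounds this below by a multiple of the Lyapunov function, which gives the linear rate.

The dual problem itself matters only at time `0`. Completing a square in the dual objective gives
strong duality and determines, at any minimizer, `A w` on centers and tokens and `μ_ij y_ij`. This
identifies `ℒ₀` with the Lyapunov function of the initial state (`lyapunovInit_eq`). The complexity
bounds multiply the number of steps needed by the probability of each kind of step. -/

noncomputable section

namespace TVR

/-! ### Bregman divergences of smooth convex functions -/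

section Convex

variable {E : Type*} [NormedAddCommGroup E] [InnerProductSpace ℝ E] [CompleteSpace E]

/-- The Bregman divergence `f x - f y - ⟪∇f y, x - y⟫` of a real function. -/
def bregDiv (f : E → ℝ) (x y : E) : ℝ := f x - f y - inner ℝ (gradient f y) (x - y)

lemma bregDiv_add_swap (f : E → ℝ) (x y : E) :
    bregDiv f x y + bregDiv f y x = inner ℝ (gradient f x - gradient f y) (x - y) := by
  simp only [bregDiv, inner_sub_left, inner_sub_right]
  ring

lemma hasDerivAt_comp_line {f : E → ℝ} (hf : Differentiable ℝ f) (y v : E) (t : ℝ) :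
    HasDerivAt (fun s : ℝ => f (y + s • v)) (inner ℝ (gradient f (y + t • v)) v) t := by
  have h1 : HasDerivAt (fun s : ℝ => y + s • v) v t := by
    simpa using ((hasDerivAt_id t).smul_const v).const_add y
  have h2 := (hf (y + t • v)).hasFDerivAt.comp_hasDerivAt t h1
  rw [inner_gradient_left]
  exact h2

lemma bregDiv_nonneg {f : E → ℝ} (hc : ConvexOn ℝ Set.univ f) (hf : Differentiable ℝ f)
    (x y : E) : 0 ≤ bregDiv f x y := by
  have hconv : ConvexOn ℝ Set.univ (fun s : ℝ => f (y + s • (x - y))) := by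
    have h : (fun s : ℝ => f (y + s • (x - y))) = f ∘ AffineMap.lineMap y x := by
      ext s
      simp [AffineMap.lineMap_apply, add_comm]
    rw [h]
    exact hc.comp_affineMap _
  have h := hconv.le_slope_of_hasDerivAt (Set.mem_univ 0) (Set.mem_univ 1) one_pos
    (hasDerivAt_comp_line hf y (x - y) 0)
  simp only [slope_def_field, zero_smul, one_smul, add_zero, sub_zero, div_one,
    add_sub_cancel] at h
  unfold bregDiv
  linarith

/-- Along the segment from `y` to `x`, the remainder minus its quadratic bound has nonpositive
derivative, by Cauchy-Schwarz and the Lipschitz gradient. -/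
lemma bregDiv_le {f : E → ℝ} (hf : Differentiable ℝ f) {L : ℝ}
    (hs : ∀ x y, ‖gradient f x - gradient f y‖ ≤ L * ‖x - y‖) (x y : E) :
    bregDiv f x y ≤ L / 2 * ‖x - y‖ ^ 2 := by
  set v := x - y with hv
  have hd : ∀ t : ℝ, HasDerivAt
      (fun s : ℝ => f (y + s • v) - s * inner ℝ (gradient f y) v - s ^ 2 * (L / 2 * ‖v‖ ^ 2))
      (inner ℝ (gradient f (y + t • v)) v - inner ℝ (gradient f y) v - t * (L * ‖v‖ ^ 2)) t := by
    intro t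
    have h := ((hasDerivAt_comp_line hf y v t).sub
      ((hasDerivAt_id t).mul_const (inner ℝ (gradient f y) v))).sub
      (((hasDerivAt_id t).pow 2).mul_const (L / 2 * ‖v‖ ^ 2))
    refine h.congr_deriv ?_
    simp
    ring
  have hanti := antitoneOn_of_deriv_nonpos (convex_Icc (0 : ℝ) 1)
    (fun t _ => (hd t).continuousAt.continuousWithinAt)
    (fun t _ => (hd t).differentiableAt.differentiableWithinAt) (fun t ht => by
      rw [interior_Icc] at ht
      rw [(hd t).deriv, ← inner_sub_left]
      have h1 := real_inner_le_norm (gradient f (y + t • v) - gradient f y) v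
      have h2 := hs (y + t • v) y
      rw [add_sub_cancel_left, norm_smul, Real.norm_of_nonneg ht.1.le] at h2
      nlinarith [norm_nonneg v])
  have h := hanti (Set.left_mem_Icc.2 zero_le_one) (Set.right_mem_Icc.2 zero_le_one) zero_le_one
  have hx : y + v = x := by simp [hv]
  simp only [zero_smul, one_smul, add_zero, hx] at h
  unfold bregDiv
  linarith

/-- Cocoercivity of the gradient of a smooth convex function. -/
lemma sq_norm_gradient_sub_le {f : E → ℝ} (hc : ConvexOn ℝ Set.univ f) (hf : Differentiable ℝ f)
    {L : ℝ} (hL : 0 < L) (hs : ∀ x y, ‖gradient f x - gradient f y‖ ≤ L * ‖x - y‖) (x y : E) :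
    ‖gradient f x - gradient f y‖ ^ 2 ≤ 2 * L * bregDiv f x y := by
  set g := gradient f x - gradient f y with hg
  -- `f - ⟪∇f y, ·⟫` has gradient `g` at `x`, and `u` minimizes its quadratic upper bound there.
  -- Convexity from `y` bounds `f u` below, smoothness from `x` bounds it above.
  set u := x - (1 / L) • g with hu
  have h1 := bregDiv_nonneg hc hf u y
  have h2 := bregDiv_le hf hs u x
  have hux : u - x = -((1 / L) • g) := by simp [hu]
  have huy : u - y = (x - y) - (1 / L) • g := by rw [hu]; abel
  have hgg : inner ℝ g g = ‖g‖ ^ 2 := real_inner_self_eq_norm_sq g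
  have h3 : inner ℝ (gradient f x) g - inner ℝ (gradient f y) g = ‖g‖ ^ 2 := by
    rw [← inner_sub_left, ← hg, hgg]
  unfold bregDiv at *
  rw [huy, inner_sub_right, real_inner_smul_right] at h1
  rw [hux, inner_neg_right, real_inner_smul_right, norm_neg, norm_smul, mul_pow,
    Real.norm_of_nonneg (by positivity)] at h2
  have h4 : L / 2 * ((1 / L) ^ 2 * ‖g‖ ^ 2) = (1 / L) * ‖g‖ ^ 2 / 2 := by field_simp
  have h5 : 1 / L * ‖g‖ ^ 2 / 2 ≤ f x - f y - inner ℝ (gradient f y) (x - y) := by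
    rw [h4] at h2
    have : 1 / L * inner ℝ (gradient f x) g - 1 / L * inner ℝ (gradient f y) g
      = 1 / L * ‖g‖ ^ 2 := by rw [← mul_sub, h3]
    linarith
  calc ‖g‖ ^ 2 = 2 * L * (1 / L * ‖g‖ ^ 2 / 2) := by field_simp
    _ ≤ _ := by gcongr

/-- `θ` minimizes `f - ⟪l, ·⟫`, so the derivative vanishes there. This reads off `μ_ij y_ij` at a
dual minimizer without differentiating a conjugate. -/
lemma gradient_eq_of_forall_le {f : E → ℝ} (hf : Differentiable ℝ f) {l θ : E}
    (h : ∀ θ', f θ + inner ℝ l (θ' - θ) ≤ f θ') : gradient f θ = l := by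
  have hmin : IsLocalMin (fun θ' => f θ' - innerSL ℝ l θ') θ := by
    refine Filter.Eventually.of_forall fun θ' => ?_
    have := h θ'
    rw [inner_sub_right] at this
    simp only [innerSL_apply_apply]
    linarith
  have h0 := hmin.hasFDerivAt_eq_zero ((hf θ).hasFDerivAt.sub (innerSL ℝ l).hasFDerivAt)
  refine ext_inner_right ℝ fun v => ?_
  rw [inner_gradient_left]
  have := congrArg (fun T => T v) h0
  simp at this
  linarith

end Convex

/-! ### Conjugates at gradients -/

section Conj

variable {d : ℕ} {f : Vec d → ℝ}

lemma le_conj (f : Vec d → ℝ) (l θ : Vec d) :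
    ((inner ℝ l θ - f θ : ℝ) : EReal) ≤ conj f l :=
  le_iSup (fun θ : Vec d => ((inner ℝ l θ - f θ : ℝ) : EReal)) θ

/-- By convexity the supremum is attained at `z`. The initial and the optimal dual points have all
their computation components of this form, so no other value of a conjugate is ever computed. -/
lemma conj_gradient (hc : ConvexOn ℝ Set.univ f) (hf : Differentiable ℝ f) (z : Vec d) :
    conj f (gradient f z) = ((inner ℝ (gradient f z) z - f z : ℝ) : EReal) := by
  refine le_antisymm (iSup_le fun θ => ?_) (le_conj f _ z)
  rw [EReal.coe_le_coe_iff]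
  have := bregDiv_nonneg hc hf θ z
  rw [bregDiv, inner_sub_right] at this
  linarith

end Conj

/-! ### Row-space projections of the conceptual graph -/

section PinvProj

variable {ι κ : Type*} [Fintype ι] [Fintype κ] [DecidableEq κ]

/-- Characterization of a column of `M†M`: it is orthogonal to `ker M` and differs from the basis
vector by an element of `ker M`. -/
lemma pinvProj_eq (M : Matrix ι κ ℝ) (b : κ) (v : κ → ℝ)
    (hv : ∀ x : κ → ℝ, (∀ i, ∑ a, M i a * x a = 0) → ∑ a, v a * x a = 0)
    (hz : ∀ i, ∑ a, M i a * ((if a = b then 1 else 0) - v a) = 0) (a : κ) :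
    pinvProj M a b = v a := by
  have hker : ∀ x : EuclideanSpace ℝ κ, x ∈ LinearMap.ker (Matrix.toEuclideanLin M) ↔
      ∀ i, ∑ a, M i a * x a = 0 := by
    intro x
    rw [LinearMap.mem_ker]
    constructor
    · intro h i
      have := congrArg (fun y : EuclideanSpace ℝ ι => y i) h
      simpa [Matrix.toLpLin_apply, Matrix.mulVec, dotProduct] using this
    · intro h
      ext i
      simpa [Matrix.toLpLin_apply, Matrix.mulVec, dotProduct] using h i
  have h := Submodule.eq_starProjection_of_mem_orthogonal
    (K := (LinearMap.ker (Matrix.toEuclideanLin M))ᗮ) (u := EuclideanSpace.single b (1 : ℝ))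
    (v := WithLp.toLp 2 v) ?_ ?_
  · unfold pinvProj
    rw [h]
  · rw [Submodule.mem_orthogonal]
    intro x hx
    have := hv x ((hker x).1 hx)
    simpa [PiLp.inner_apply] using this
  · rw [Submodule.orthogonal_orthogonal, hker]
    intro i
    simpa [Pi.single_apply] using hz i

end PinvProj

namespace Problem

variable {d n m K : ℕ} (Q : Problem d n m K) {V : Type*} [AddCommGroup V] [Module ℝ V]

lemma incidence_comp (w : Edge n m K → V) (i : Fin n) (j : Fin m) :
    ∑ e, Q.incidence (.inl (i, j)) e • w e = Q.weight (.inr (i, j)) • w (.inr (i, j)) := by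
  simp only [Fintype.sum_sum_type, Fintype.sum_prod_type]
  simp [incidence, head, tail, ite_and, ite_smul, Finset.sum_ite_irrel]

lemma incidence_center (w : Edge n m K → V) (i : Fin n) :
    ∑ e, Q.incidence (.inr (.inl i)) e • w e
      = ∑ k, w (.inl (i, k)) - ∑ j, Q.weight (.inr (i, j)) • w (.inr (i, j)) := by
  simp only [Fintype.sum_sum_type, Fintype.sum_prod_type]
  simp [incidence, head, tail, ite_smul, weight, sub_eq_add_neg]

lemma incidence_token (w : Edge n m K → V) (k : Fin K) :
    ∑ e, Q.incidence (.inr (.inr k)) e • w e = -∑ i, w (.inl (i, k)) := by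
  simp only [Fintype.sum_sum_type, Fintype.sum_prod_type]
  simp [incidence, head, tail, ite_smul, weight, sub_eq_add_neg]

lemma incidenceComm_center (x : Fin n × Fin K → ℝ) (i : Fin n) :
    ∑ e, Q.incidenceComm (.inl i) e * x e = ∑ k, x (i, k) := by
  have h := Q.incidence_center (Sum.elim x (fun _ => (0 : ℝ))) i
  simpa [Fintype.sum_sum_type, incidenceComm] using h

lemma incidenceComm_token (x : Fin n × Fin K → ℝ) (k : Fin K) :
    ∑ e, Q.incidenceComm (.inr k) e * x e = -∑ i, x (i, k) := by
  have h := Q.incidence_token (Sum.elim x (fun _ => (0 : ℝ))) k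
  simpa [Fintype.sum_sum_type, incidenceComm] using h

end Problem

/-- The entries of `A_comm†A_comm` for the complete bipartite communication graph. -/
def commProj {n K : ℕ} (e e' : Fin n × Fin K) : ℝ :=
  (if e.1 = e'.1 then 1 / (K : ℝ) else 0) + (if e.2 = e'.2 then 1 / (n : ℝ) else 0)
    - 1 / (n * K)

lemma commProj_sum {n K : ℕ} {V : Type*} [AddCommGroup V] [Module ℝ V] (x : Fin n × Fin K → V)
    (i : Fin n) (k : Fin K) :
    ∑ e, commProj (i, k) e • x e = (1 / (K : ℝ)) • ∑ k', x (i, k')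
      + (1 / (n : ℝ)) • ∑ i', x (i', k) - (1 / (n * K : ℝ)) • ∑ i', ∑ k', x (i', k') := by
  simp [commProj, Fintype.sum_prod_type, add_smul, sub_smul, Finset.sum_add_distrib,
    ite_smul, Finset.smul_sum]
  rw [Finset.sum_eq_single i] <;> simp +contextual [eq_comm]

lemma commProj_symm {n K : ℕ} (e e' : Fin n × Fin K) : commProj e e' = commProj e' e := by
  simp [commProj, eq_comm]

lemma commProj_sum_left {n K : ℕ} (x : Fin n × Fin K → ℝ)
    (hr : ∀ i, ∑ k, x (i, k) = 0) (hc : ∀ k, ∑ i, x (i, k) = 0) (e : Fin n × Fin K) :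
    ∑ a, commProj a e * x a = 0 := by
  obtain ⟨i, k⟩ := e
  have h := commProj_sum x i k
  simp only [hr, hc, Finset.sum_const_zero, smul_zero, add_zero, sub_zero] at h
  rw [← h]
  exact Finset.sum_congr rfl fun a _ => by rw [commProj_symm, smul_eq_mul]

/-- With `sum_commProj_col`, this says that the columns of `I - commProj` lie in the kernel of
`A_comm`. -/
lemma sum_commProj_row {n K : ℕ} (hn : 0 < n) (hK : 0 < K) (i : Fin n) (e : Fin n × Fin K) :
    ∑ k, ((if (i, k) = e then 1 else 0) - commProj (i, k) e) = 0 := by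
  obtain ⟨i', k'⟩ := e
  have h1 : (n : ℝ) ≠ 0 := by positivity
  have h2 : (K : ℝ) ≠ 0 := by positivity
  by_cases h : i = i' <;>
    simp [commProj, h, Finset.sum_add_distrib] <;> field_simp <;> ring

lemma sum_commProj_col {n K : ℕ} (hn : 0 < n) (hK : 0 < K) (k : Fin K) (e : Fin n × Fin K) :
    ∑ i, ((if (i, k) = e then 1 else 0) - commProj (i, k) e) = 0 := by
  obtain ⟨i', k'⟩ := e
  have h1 : (n : ℝ) ≠ 0 := by positivity
  have h2 : (K : ℝ) ≠ 0 := by positivity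
  by_cases h : k = k' <;>
    simp [commProj, h, Finset.sum_add_distrib] <;> field_simp <;> ring

namespace Problem

variable {d n m K : ℕ} (Q : Problem d n m K)

lemma pinvProj_incidenceComm (hn : 0 < n) (hK : 0 < K) (e e' : Fin n × Fin K) :
    pinvProj Q.incidenceComm e e' = commProj e e' := by
  refine pinvProj_eq _ e' (fun e => commProj e e') (fun x hx => ?_) (fun v => ?_) e
  · refine commProj_sum_left x (fun i => ?_) (fun k => ?_) e'
    · rw [← Q.incidenceComm_center]
      exact hx _
    · rw [← neg_eq_zero, ← Q.incidenceComm_token]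
      exact hx _
  · rcases v with i | k
    · exact (Q.incidenceComm_center _ i).trans (sum_commProj_row hn hK i e')
    · rw [Q.incidenceComm_token, neg_eq_zero]
      exact sum_commProj_col hn hK k e'

/-- A computation node is a leaf, so its equation kills the variable on its only edge; what remains
is the kernel of `A_comm`. -/
lemma eq_zero_of_incidence_eq_zero (hw : ∀ i j, Q.weight (.inr (i, j)) ≠ 0)
    {x : Edge n m K → ℝ} (hx : ∀ v, ∑ e, Q.incidence v e * x e = 0) :
    (∀ i j, x (.inr (i, j)) = 0) ∧ (∀ i, ∑ k, x (.inl (i, k)) = 0) ∧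
      ∀ k, ∑ i, x (.inl (i, k)) = 0 := by
  have h0 : ∀ i j, x (.inr (i, j)) = 0 := fun i j => by
    have h := (Q.incidence_comp x i j).symm.trans (hx (.inl (i, j)))
    simpa [hw i j] using h
  refine ⟨h0, fun i => ?_, fun k => ?_⟩
  · have h := (Q.incidence_center x i).symm.trans (hx (.inr (.inl i)))
    simpa [h0] using h
  · have h := (Q.incidence_token x k).symm.trans (hx (.inr (.inr k)))
    simpa using h

/-- The kernel of `A` is that of `A_comm` extended by zero, so the column of `A†A` at a
communication edge is the column of `commProj` extended by zero. -/
lemma R_inl (hn : 0 < n) (hK : 0 < K) (hw : ∀ i j, Q.weight (.inr (i, j)) ≠ 0)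
    (e : Fin n × Fin K) : Q.R (.inl e) = 1 / K + 1 / n - 1 / (n * K) := by
  have h := pinvProj_eq Q.incidence (.inl e) (Sum.elim (fun e' => commProj e' e) (fun _ => 0))
    (fun x hx => by
      obtain ⟨-, hr, hc⟩ := Q.eq_zero_of_incidence_eq_zero hw hx
      rw [Fintype.sum_sum_type]
      simpa using commProj_sum_left (fun e' => x (.inl e')) hr hc e) (fun v => by
      rcases v with ⟨i, j⟩ | i | k
      · refine (Q.incidence_comp _ i j).trans ?_
        simp only [Sum.elim_inr, reduceCtorEq, if_false, sub_self, smul_zero]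
      · refine (Q.incidence_center _ i).trans ?_
        simp only [Sum.inl.injEq, Sum.elim_inl, Sum.elim_inr, reduceCtorEq, if_false, sub_zero,
          sub_self, smul_zero, Finset.sum_const_zero]
        exact sum_commProj_row hn hK i e
      · refine (Q.incidence_token _ k).trans ?_
        simp only [Sum.inl.injEq, Sum.elim_inl, neg_eq_zero]
        exact sum_commProj_col hn hK k e) (.inl e)
  rw [R, h, Sum.elim_inl, commProj]
  simp

lemma R_inr (hw : ∀ i j, Q.weight (.inr (i, j)) ≠ 0) (e : Fin n × Fin m) :
    Q.R (.inr e) = 1 := by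
  have h := pinvProj_eq Q.incidence (.inr e) (fun e' => if e' = .inr e then 1 else 0)
    (fun x hx => by
      obtain ⟨h0, -, -⟩ := Q.eq_zero_of_incidence_eq_zero hw hx
      simp only [ite_mul, one_mul, zero_mul, Finset.sum_ite_eq', Finset.mem_univ, if_true]
      exact h0 e.1 e.2) (fun v => by simp only [sub_self, mul_zero, Finset.sum_const_zero]) (.inr e)
  rw [R, h, if_pos rfl]

end Problem
end TVR
end

noncomputable section

namespace TVR

/-- The standing assumptions on the problem. -/
structure Problem.Regular {d n m K : ℕ} (Q : Problem d n m K) : Prop where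
  one_le_m : 1 ≤ m
  one_le_K : 1 ≤ K
  K_le_n : K ≤ n
  σ_pos : 0 < Q.σ
  L_pos : ∀ i j, 0 < Q.L i j
  convex : ∀ i j, ConvexOn ℝ Set.univ (Q.f i j)
  diff : ∀ i j, Differentiable ℝ (Q.f i j)
  smooth : ∀ i j x y,
    ‖gradient (Q.f i j) x - gradient (Q.f i j) y‖ ≤ Q.L i j * ‖x - y‖

namespace Problem.Regular

variable {d n m K : ℕ} {Q : Problem d n m K} {pcomp : ℝ}

/-! ### Step-size constraints and edge constants -/

section Parameters

lemma n_pos (h : Q.Regular) : 0 < n := lt_of_lt_of_le h.one_le_K h.K_le_n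

lemma cast_n_pos (h : Q.Regular) : (0 : ℝ) < n := Nat.cast_pos.2 h.n_pos

lemma cast_K_pos (h : Q.Regular) : (0 : ℝ) < K := Nat.cast_pos.2 h.one_le_K

lemma one_le_cast_m (h : Q.Regular) : (1 : ℝ) ≤ m := Nat.one_le_cast.2 h.one_le_m

lemma cast_K_le_n (h : Q.Regular) : (K : ℝ) ≤ n := Nat.cast_le.2 h.K_le_n

lemma sigmaT_pos (h : Q.Regular) : 0 < Q.sigmaT := by
  have h1 := h.cast_n_pos
  have h2 := h.σ_pos
  unfold sigmaT
  positivity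

lemma le_kappaS (i : Fin n) : 1 + ∑ j, Q.L i j / Q.sigmaT ≤ Q.kappaS :=
  le_ciSup (f := fun i => 1 + ∑ j, Q.L i j / Q.sigmaT) (Set.finite_range _).bddAbove i

lemma one_le_kappaS (h : Q.Regular) : 1 ≤ Q.kappaS := by
  refine le_trans ?_ (le_kappaS (Q := Q) ⟨0, h.n_pos⟩)
  have := Finset.sum_nonneg fun j (_ : j ∈ Finset.univ) =>
    (div_pos (h.L_pos ⟨0, h.n_pos⟩ j) h.sigmaT_pos).le
  linarith

lemma kappaS_pos (h : Q.Regular) : 0 < Q.kappaS := one_pos.trans_le h.one_le_kappaS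

lemma alpha_pos (h : Q.Regular) : 0 < Q.alpha := by
  have h1 := h.cast_K_pos
  have h2 := h.sigmaT_pos
  have h3 := h.kappaS_pos
  unfold alpha
  positivity

lemma weight_sq (h : Q.Regular) (i : Fin n) (j : Fin m) :
    Q.weight (.inr (i, j)) ^ 2 = Q.alpha * Q.L i j :=
  Real.sq_sqrt (mul_pos h.alpha_pos (h.L_pos i j)).le

lemma weight_pos (h : Q.Regular) (i : Fin n) (j : Fin m) : 0 < Q.weight (.inr (i, j)) :=
  Real.sqrt_pos.2 (mul_pos h.alpha_pos (h.L_pos i j))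

lemma m_sub_one_add_kappaS_pos (h : Q.Regular) : 0 < (m : ℝ) - 1 + Q.kappaS := by
  linarith [h.one_le_cast_m, h.kappaS_pos]

lemma eta_pos (h : Q.Regular) (hp0 : 0 < pcomp) (hp1 : pcomp < 1) : 0 < Q.eta pcomp := by
  have h1 := h.cast_n_pos
  have h2 := h.cast_K_pos
  have h3 := h.m_sub_one_add_kappaS_pos
  have h4 := h.sigmaT_pos
  have h5 := h.alpha_pos
  have h6 := sub_pos.2 hp1
  unfold eta
  positivity

lemma one_add_L_div_pos (h : Q.Regular) (i : Fin n) (j : Fin m) :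
    0 < 1 + Q.L i j / Q.sigmaT := by
  have := div_pos (h.L_pos i j) h.sigmaT_pos
  linarith

lemma sum_one_add_L_div_pos (h : Q.Regular) (i : Fin n) :
    0 < ∑ j, (1 + Q.L i j / Q.sigmaT) :=
  Finset.sum_pos (fun j _ => h.one_add_L_div_pos i j) ⟨⟨0, h.one_le_m⟩, Finset.mem_univ _⟩

lemma sum_one_add_L_div_le (i : Fin n) :
    ∑ j, (1 + Q.L i j / Q.sigmaT) ≤ m - 1 + Q.kappaS := by
  have := le_kappaS (Q := Q) i
  simp only [Finset.sum_add_distrib, Finset.sum_const, Finset.card_univ, Fintype.card_fin,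
    nsmul_eq_mul, mul_one]
  linarith

lemma prob_pos (h : Q.Regular) (hp0 : 0 < pcomp) (hp1 : pcomp < 1) (e : Edge n m K) :
    0 < Q.prob pcomp e := by
  have h1 := h.cast_n_pos
  have h2 := h.cast_K_pos
  have h6 := sub_pos.2 hp1
  rcases e with e | ⟨i, j⟩
  · unfold prob
    positivity
  · have h3 := h.one_add_L_div_pos i j
    have h4 := h.sum_one_add_L_div_pos i
    unfold prob
    positivity

/-- The relative smoothness constraint on computation edges. -/
lemma alpha_eta_le (h : Q.Regular) (hp0 : 0 < pcomp) (i : Fin n) (j : Fin m) :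
    Q.alpha * Q.eta pcomp * (1 + Q.L i j / Q.sigmaT) ≤ Q.prob pcomp (.inr (i, j)) := by
  have h1 := h.cast_n_pos
  have h3 := h.one_add_L_div_pos i j
  have h4 := h.sum_one_add_L_div_pos i
  have h5 := sum_one_add_L_div_le (Q := Q) i
  have h6 := h.m_sub_one_add_kappaS_pos
  have h7 := h.alpha_pos
  have h8 : Q.eta pcomp ≤ pcomp / (Q.alpha * n * (m - 1 + Q.kappaS)) := min_le_right _ _
  have h9 : Q.alpha * Q.eta pcomp ≤ pcomp / n / (m - 1 + Q.kappaS) := by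
    calc Q.alpha * Q.eta pcomp ≤ Q.alpha * (pcomp / (Q.alpha * n * (m - 1 + Q.kappaS))) := by
          gcongr
      _ = _ := by field_simp
  calc Q.alpha * Q.eta pcomp * (1 + Q.L i j / Q.sigmaT)
      ≤ pcomp / n / (m - 1 + Q.kappaS) * (1 + Q.L i j / Q.sigmaT) := by gcongr
    _ ≤ pcomp / n / (∑ j, (1 + Q.L i j / Q.sigmaT)) * (1 + Q.L i j / Q.sigmaT) := by gcongr
    _ = _ := by unfold prob; ring

lemma rhoComm_le (h : Q.Regular) (hp1 : pcomp < 1) : Q.rhoComm pcomp ≤ 1 / 2 := by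
  have h1 := h.cast_n_pos
  have h2 := h.cast_K_pos
  have h4 := h.sigmaT_pos
  have h6 := sub_pos.2 hp1
  have h8 : Q.eta pcomp ≤ Q.sigmaT * (1 - pcomp) / (2 * n * K) := min_le_left _ _
  calc Q.rhoComm pcomp
      ≤ n * K * (Q.sigmaT * (1 - pcomp) / (2 * n * K)) / ((1 - pcomp) * Q.sigmaT) := by
        unfold rhoComm
        gcongr
    _ = 1 / 2 := by field_simp

/-- A token jump is a dual step of length `η / p_e` along its edge, so weighting by `p_e` leaves the
same factor `η` on every edge. -/
lemma sigmaT_mul_rhoComm (h : Q.Regular) (hp1 : pcomp < 1) (e : Fin n × Fin K) :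
    Q.sigmaT * Q.rhoComm pcomp = Q.eta pcomp / Q.prob pcomp (.inl e) := by
  have h1 := h.cast_n_pos
  have h2 := h.cast_K_pos
  have h4 := h.sigmaT_pos
  have h6 := sub_pos.2 hp1
  unfold rhoComm prob
  field_simp

lemma rhoComp_pos (h : Q.Regular) (hp0 : 0 < pcomp) (hp1 : pcomp < 1) (i : Fin n) (j : Fin m) :
    0 < Q.rhoComp pcomp i j :=
  div_pos (mul_pos h.alpha_pos (h.eta_pos hp0 hp1)) (h.prob_pos hp0 hp1 _)

lemma rhoComp_mul_le (h : Q.Regular) (hp0 : 0 < pcomp) (hp1 : pcomp < 1)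
    (i : Fin n) (j : Fin m) :
    Q.rhoComp pcomp i j * (1 + Q.L i j / Q.sigmaT) ≤ 1 := by
  unfold rhoComp
  rw [div_mul_eq_mul_div, div_le_one (h.prob_pos hp0 hp1 _)]
  exact h.alpha_eta_le hp0 i j

lemma R_inl (h : Q.Regular) (e : Fin n × Fin K) :
    Q.R (.inl e) = 1 / K + 1 / n - 1 / (n * K) :=
  Q.R_inl h.n_pos h.one_le_K (fun i j => (h.weight_pos i j).ne') e

lemma R_inr (h : Q.Regular) (e : Fin n × Fin m) : Q.R (.inr e) = 1 :=
  Q.R_inr (fun i j => (h.weight_pos i j).ne') e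

lemma R_pos (h : Q.Regular) (e : Edge n m K) : 0 < Q.R e := by
  rcases e with e | e
  · rw [h.R_inl]
    have h1 := h.cast_n_pos
    have h2 := h.cast_K_pos
    have h3 : (1 : ℝ) ≤ K := Nat.one_le_cast.2 h.one_le_K
    have h4 : 1 / (n * K : ℝ) ≤ 1 / n := by
      gcongr
      nlinarith
    have : (0 : ℝ) < 1 / K := by positivity
    linarith
  · rw [h.R_inr]
    exact one_pos

lemma Rp_le (e : Edge n m K) : Q.Rp pcomp ≤ Q.prob pcomp e / Q.R e :=
  ciInf_le (f := fun e => Q.prob pcomp e / Q.R e) (Set.finite_range _).bddBelow e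

lemma exists_Rp_eq (h : Q.Regular) : ∃ e, Q.prob pcomp e / Q.R e = Q.Rp pcomp := by
  have : Nonempty (Edge n m K) := ⟨.inl (⟨0, h.n_pos⟩, ⟨0, h.one_le_K⟩)⟩
  exact exists_eq_ciInf_of_finite

lemma Rp_pos (h : Q.Regular) (hp0 : 0 < pcomp) (hp1 : pcomp < 1) : 0 < Q.Rp pcomp := by
  obtain ⟨e, he⟩ := h.exists_Rp_eq (pcomp := pcomp)
  rw [← he]
  exact div_pos (h.prob_pos hp0 hp1 e) (h.R_pos e)

/-- The contribution of the dual gap to the rate is a bounded fraction of it. -/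
lemma rate_div_Rp_le (h : Q.Regular) (hp0 : 0 < pcomp) (hp1 : pcomp < 1) :
    K / (Q.sigmaT * Q.kappaS) * (Q.eta pcomp / Q.Rp pcomp) ≤ 1 / 2 ∨
      K / (Q.sigmaT * Q.kappaS) * (Q.eta pcomp / Q.Rp pcomp) ≤ 1 / Q.kappaS := by
  have h1 := h.cast_n_pos
  have h2 := h.cast_K_pos
  have h4 := h.sigmaT_pos
  have h5 := h.kappaS_pos
  -- The alternative depends on the kind of edge attaining `R_p`: a communication edge gives `1 /
  -- κ_s`, a computation edge gives `1 / 2`.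
  obtain ⟨e, he⟩ := h.exists_Rp_eq (pcomp := pcomp)
  rw [← he, div_div_eq_mul_div]
  have hp := h.prob_pos hp0 hp1 e
  rcases e with e | ⟨i, j⟩
  · right
    have h6 := sub_pos.2 hp1
    have h8 : Q.eta pcomp ≤ Q.sigmaT * (1 - pcomp) / (2 * n * K) := min_le_left _ _
    have hR := h.R_pos (.inl e)
    calc K / (Q.sigmaT * Q.kappaS) * (Q.eta pcomp * Q.R (.inl e) / Q.prob pcomp (.inl e))
        ≤ K / (Q.sigmaT * Q.kappaS) * (Q.sigmaT * (1 - pcomp) / (2 * n * K) * Q.R (.inl e)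
          / Q.prob pcomp (.inl e)) := by gcongr
      _ = (K * Q.R (.inl e) / 2) * (1 / Q.kappaS) := by unfold prob; field_simp
      _ ≤ 1 * (1 / Q.kappaS) := by
        gcongr
        rw [h.R_inl]
        have h9 := h.cast_K_le_n
        -- `K R_e = 1 + (K - 1) / n ≤ 2`, because `K ≤ n`.
        have : (K : ℝ) * (1 / K + 1 / n - 1 / (n * K)) = 1 + K / n - 1 / n := by field_simp
        rw [this]
        have : (K : ℝ) / n ≤ 1 := (div_le_one h1).2 h9
        have : 0 < 1 / (n : ℝ) := by positivity
        linarith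
      _ = _ := one_mul _
  · left
    have h3 := div_pos (h.L_pos i j) h4
    have h7 := h.alpha_eta_le hp0 i j
    have h8 := mul_pos h.alpha_pos (h.eta_pos hp0 hp1)
    rw [h.R_inr, mul_one]
    have h9 : K / (Q.sigmaT * Q.kappaS) = Q.alpha / 2 := by unfold alpha; field_simp
    rw [h9, ← mul_div_assoc, div_le_iff₀ hp]
    nlinarith [mul_pos h8 h3]

end Parameters

end Problem.Regular

lemma sum_apply_update {ι α β : Type*} [Fintype ι] [DecidableEq ι] [AddCommGroup β]
    (F : ι → α → β) (g : ι → α) (i : ι) (v : α) :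
    ∑ j, F j (Function.update g i v j) = ∑ j, F j (g j) + (F i v - F i (g i)) := by
  rw [← Finset.add_sum_erase _ _ (Finset.mem_univ i),
    ← Finset.add_sum_erase Finset.univ (fun j => F j (g j)) (Finset.mem_univ i)]
  rw [Finset.sum_congr rfl fun j hj => by
    rw [Function.update_of_ne (Finset.ne_of_mem_erase hj)]]
  simp only [Function.update_self]
  abel

/-! ### The dual seminorm on the complete bipartite graph -/

section Energy

variable {E : Type*} [NormedAddCommGroup E] [InnerProductSpace ℝ E] {n K : ℕ}

/-- The squared seminorm `‖x‖²` of `A_comm†A_comm`, in terms of the components `a` (at the center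
nodes) and `b` (at the tokens) of `A_comm x`. -/
def energy {E : Type*} [NormedAddCommGroup E] {n K : ℕ} (a : Fin n → E) (b : Fin K → E) : ℝ :=
  (∑ i, ‖a i‖ ^ 2) / K + (∑ k, ‖b k‖ ^ 2) / n - ‖∑ i, a i‖ ^ 2 / (n * K)

lemma norm_sq_sum_le {E : Type*} [NormedAddCommGroup E] {n : ℕ} (a : Fin n → E) : ‖∑ i, a i‖ ^ 2 ≤ n * ∑ i, ‖a i‖ ^ 2 := by
  calc ‖∑ i, a i‖ ^ 2 ≤ (∑ i, ‖a i‖) ^ 2 := by gcongr; exact norm_sum_le _ _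
    _ ≤ _ := by simpa using sq_sum_le_card_mul_sum_sq (s := Finset.univ) (f := fun i => ‖a i‖)

lemma energy_nonneg {E : Type*} [NormedAddCommGroup E] {n K : ℕ} (hn : 0 < n) (a : Fin n → E) (b : Fin K → E) : 0 ≤ energy a b := by
  have h1 : (0 : ℝ) < n := Nat.cast_pos.2 hn
  have h2 := norm_sq_sum_le a
  have h3 : ‖∑ i, a i‖ ^ 2 / (n * K) ≤ (∑ i, ‖a i‖ ^ 2) / K := by
    calc ‖∑ i, a i‖ ^ 2 / (n * K) ≤ (n * ∑ i, ‖a i‖ ^ 2) / (n * K) := by gcongr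
      _ = _ := mul_div_mul_left _ _ h1.ne'
  have h4 : 0 ≤ (∑ k, ‖b k‖ ^ 2) / (n : ℝ) := by positivity
  unfold energy
  linarith

lemma energy_le {E : Type*} [NormedAddCommGroup E] {n K : ℕ} (hK : 0 < K) (hKn : K ≤ n) (a : Fin n → E) (b : Fin K → E) :
    energy a b ≤ (∑ i, ‖a i‖ ^ 2 + ∑ k, ‖b k‖ ^ 2) / K := by
  have h2 : (0 : ℝ) < K := Nat.cast_pos.2 hK
  have h3 : (K : ℝ) ≤ n := Nat.cast_le.2 hKn
  have h4 : (∑ k, ‖b k‖ ^ 2) / (n : ℝ) ≤ (∑ k, ‖b k‖ ^ 2) / K := by gcongr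
  have h5 : 0 ≤ ‖∑ i, a i‖ ^ 2 / (n * K : ℝ) := by positivity
  unfold energy
  rw [add_div]
  linarith

lemma norm_sub_sq_sub (x u : E) : ‖x - u‖ ^ 2 - ‖x‖ ^ 2 = ‖u‖ ^ 2 - 2 * inner ℝ x u := by
  rw [norm_sub_sq_real]
  ring

lemma norm_add_sq_sub (x u : E) : ‖x + u‖ ^ 2 - ‖x‖ ^ 2 = ‖u‖ ^ 2 + 2 * inner ℝ x u := by
  rw [norm_add_sq_real]
  ring

/-- The update moves `x` along the edge `(i, k)`. The coefficient of `‖u‖²` is `R_e`, and the vector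
paired with `u` is the component on that edge of `A_comm†(a, b)`. -/
lemma energy_update (a : Fin n → E) (b : Fin K → E) (i : Fin n) (k : Fin K) (u : E) :
    energy (Function.update a i (a i - u)) (Function.update b k (b k + u))
      = energy a b + (1 / K + 1 / n - 1 / (n * K)) * ‖u‖ ^ 2
        - 2 * inner ℝ ((1 / K : ℝ) • a i - (1 / n : ℝ) • b k - (1 / (n * K) : ℝ) • ∑ i, a i) u := by
  have h1 := sum_apply_update (fun _ x => ‖x‖ ^ 2) a i (a i - u)
  have h2 := sum_apply_update (fun _ x => ‖x‖ ^ 2) b k (b k + u)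
  have h3 := sum_apply_update (fun _ x => x) a i (a i - u)
  rw [norm_sub_sq_sub] at h1
  rw [norm_add_sq_sub] at h2
  rw [sub_sub_cancel_left, ← sub_eq_add_neg] at h3
  unfold energy
  rw [h1, h2, h3, norm_sub_sq_real, inner_sub_left, inner_sub_left, real_inner_smul_left,
    real_inner_smul_left, real_inner_smul_left]
  ring

/-- Duality between `A_comm x` and a difference of potentials. -/
lemma sum_inner_edge (hn : 0 < n) (hK : 0 < K) (a p : Fin n → E) (b q : Fin K → E)
    (hab : ∑ i, a i + ∑ k, b k = 0) :
    ∑ i, ∑ k, inner ℝ ((1 / K : ℝ) • a i - (1 / n : ℝ) • b k - (1 / (n * K) : ℝ) • ∑ i, a i)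
      (p i - q k) = ∑ i, inner ℝ (a i) (p i) + ∑ k, inner ℝ (b k) (q k) := by
  have h1 : (n : ℝ) ≠ 0 := by positivity
  have h2 : (K : ℝ) ≠ 0 := by positivity
  set S := ∑ i, a i with hS
  have hb : ∑ k, b k = -S := by rw [← add_eq_zero_iff_neg_eq.1 hab]
  have e1 : ∑ i, ∑ k, inner ℝ (a i) (p i - q k)
      = K * ∑ i, inner ℝ (a i) (p i) - inner ℝ S (∑ k, q k) := by
    simp only [inner_sub_right, Finset.sum_sub_distrib, Finset.sum_const, Finset.card_univ,
      Fintype.card_fin, nsmul_eq_mul, Finset.mul_sum, hS, sum_inner, inner_sum]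
    rw [Finset.sum_comm]
  have e2 : ∑ i, ∑ k, inner ℝ (b k) (p i - q k)
      = -inner ℝ S (∑ i, p i) - n * ∑ k, inner ℝ (b k) (q k) := by
    rw [← inner_neg_left, ← hb]
    simp only [inner_sub_right, Finset.sum_sub_distrib, Finset.sum_const, Finset.card_univ,
      Fintype.card_fin, nsmul_eq_mul, sum_inner, inner_sum]
  have e3 : ∑ i, ∑ k, inner ℝ S (p i - q k)
      = K * inner ℝ S (∑ i, p i) - n * inner ℝ S (∑ k, q k) := by
    simp only [inner_sub_right, Finset.sum_sub_distrib, Finset.sum_const, Finset.card_univ,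
      Fintype.card_fin, nsmul_eq_mul, inner_sum, Finset.mul_sum]
  simp only [inner_sub_left ((1 / K : ℝ) • _ - _), inner_sub_left ((1 / K : ℝ) • _),
    real_inner_smul_left, Finset.sum_sub_distrib, ← Finset.mul_sum, e1, e2, e3]
  field_simp
  ring

end Energy

/-! ### The Lyapunov function in primal variables and its change along an edge -/

namespace Problem

variable {d n m K : ℕ} (Q : Problem d n m K) (pcomp : ℝ) (θs : Vec d)

/-- Difference of the gradients at the virtual parameter and at `θs`. -/
def gradGap (s : State d n m K) (i : Fin n) (j : Fin m) : Vec d :=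
  gradient (Q.f i j) (s.z i j) - gradient (Q.f i j) θs

/-- The component at a center node of `A_comm (x - x⋆)`. -/
def nodeRes (s : State d n m K) (i : Fin n) : Vec d :=
  Q.sigmaT • (s.node i - θs) + ∑ j, Q.gradGap θs s i j

/-- The component at a token of `A_comm (x - x⋆)`. -/
def tokenRes (s : State d n m K) (k : Fin K) : Vec d := Q.sigmaT • (s.token k - θs)

/-- The dual optimality gap, in primal terms. -/
def dualGap (s : State d n m K) : ℝ :=
  Q.sigmaT / 2 * s.sqDist θs + ∑ i, ∑ j, bregDiv (Q.f i j) θs (s.z i j)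

/-- The Bregman divergence `D_h(w⋆, w)`, in primal terms. -/
def refDiv (s : State d n m K) : ℝ :=
  1 / 2 * energy (Q.nodeRes θs s) (Q.tokenRes θs s)
    + 1 / Q.alpha * ∑ i, ∑ j, bregDiv (Q.f i j) (s.z i j) θs

/-- The Lyapunov function, in primal terms. -/
def lyapunov (s : State d n m K) : ℝ :=
  Q.refDiv θs s + Q.eta pcomp / Q.Rp pcomp * Q.dualGap θs s

/-- The sum of the components of `A_comm (x - x⋆)` vanishes. -/
def Balanced (s : State d n m K) : Prop :=
  ∑ i, Q.nodeRes θs s i + ∑ k, Q.tokenRes θs s k = 0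

section Step

variable (s : State d n m K)

lemma nodeRes_step_inl (i : Fin n) (k : Fin K) :
    Q.nodeRes θs (Q.step pcomp (.inl (i, k)) s) = Function.update (Q.nodeRes θs s) i
      (Q.nodeRes θs s i - (Q.sigmaT * Q.rhoComm pcomp) • (s.node i - s.token k)) := by
  funext i'
  by_cases hi : i' = i
  · subst hi
    simp only [nodeRes, gradGap, step, Function.update_self]
    module
  · simp [nodeRes, gradGap, step, hi]

lemma tokenRes_step_inl (i : Fin n) (k : Fin K) :
    Q.tokenRes θs (Q.step pcomp (.inl (i, k)) s) = Function.update (Q.tokenRes θs s) k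
      (Q.tokenRes θs s k + (Q.sigmaT * Q.rhoComm pcomp) • (s.node i - s.token k)) := by
  funext k'
  by_cases hi : k' = k
  · subst hi
    simp only [tokenRes, step, Function.update_self]
    module
  · simp [tokenRes, step, hi]

lemma sqDist_step_inl (i : Fin n) (k : Fin K) :
    (Q.step pcomp (.inl (i, k)) s).sqDist θs = s.sqDist θs
      - 2 * Q.rhoComm pcomp * (1 - Q.rhoComm pcomp) * ‖s.node i - s.token k‖ ^ 2 := by
  simp only [State.sqDist, step]
  rw [sum_apply_update (fun _ x => ‖x - θs‖ ^ 2), sum_apply_update (fun _ x => ‖x - θs‖ ^ 2)]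
  set u := s.node i - s.token k with hu
  have h1 : s.node i + Q.rhoComm pcomp • (s.token k - s.node i) - θs
      = (s.node i - θs) - Q.rhoComm pcomp • u := by rw [hu]; module
  have h2 : s.token k - Q.rhoComm pcomp • (s.token k - s.node i) - θs
      = (s.token k - θs) + Q.rhoComm pcomp • u := by rw [hu]; module
  have h3 : inner ℝ (s.node i - θs) u - inner ℝ (s.token k - θs) u = ‖u‖ ^ 2 := by
    rw [← inner_sub_left, sub_sub_sub_cancel_right, ← hu, real_inner_self_eq_norm_sq]
  rw [h1, h2, norm_sub_sq_sub, norm_add_sq_sub, real_inner_smul_right, real_inner_smul_right,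
    norm_smul, mul_pow, Real.norm_eq_abs, sq_abs, ← h3]
  ring

lemma balanced_step_inl (i : Fin n) (k : Fin K) (hs : Q.Balanced θs s) :
    Q.Balanced θs (Q.step pcomp (.inl (i, k)) s) := by
  unfold Balanced at *
  rw [nodeRes_step_inl, tokenRes_step_inl, sum_apply_update (fun _ x => x),
    sum_apply_update (fun _ x => x)]
  rw [← hs]
  abel

end Step

end Problem

lemma sum_sum_apply_update {ι κ α β : Type*} [Fintype ι] [Fintype κ] [DecidableEq ι]
    [DecidableEq κ] [AddCommGroup β] (F : ι → κ → α → β) (g : ι → κ → α) (i : ι) (j : κ) (v : α) :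
    ∑ i', ∑ j', F i' j' (Function.update g i (Function.update (g i) j v) i' j')
      = ∑ i', ∑ j', F i' j' (g i' j') + (F i j v - F i j (g i j)) := by
  refine (sum_apply_update (fun i' x => ∑ j', F i' j' (x j')) g i _).trans ?_
  rw [sum_apply_update (F i)]
  abel

lemma bregDiv_sub_left {E : Type*} [NormedAddCommGroup E] [InnerProductSpace ℝ E]
    [CompleteSpace E] (f : E → ℝ) (x y z : E) :
    bregDiv f x z - bregDiv f y z
      = inner ℝ (gradient f y - gradient f z) (x - y) + bregDiv f x y := by
  simp only [bregDiv, inner_sub_left, inner_sub_right]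
  ring

lemma bregDiv_sub_right {E : Type*} [NormedAddCommGroup E] [InnerProductSpace ℝ E]
    [CompleteSpace E] (f : E → ℝ) (x y z : E) :
    bregDiv f z x - bregDiv f z y
      = inner ℝ (gradient f x - gradient f y) (y - z) + bregDiv f y x := by
  simp only [bregDiv, inner_sub_left, inner_sub_right]
  ring

namespace Problem

variable {d n m K : ℕ} (Q : Problem d n m K) (pcomp : ℝ) (θs : Vec d) (s : State d n m K)

/-- The virtual parameter after a computation step. -/
def zStep (i : Fin n) (j : Fin m) : Vec d :=
  (1 - Q.rhoComp pcomp i j) • s.z i j + Q.rhoComp pcomp i j • s.node i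

lemma zStep_sub (i : Fin n) (j : Fin m) :
    Q.zStep pcomp s i j - s.z i j = Q.rhoComp pcomp i j • (s.node i - s.z i j) := by
  unfold zStep
  module

lemma step_inr (i : Fin n) (j : Fin m) :
    Q.step pcomp (.inr (i, j)) s =
      { node := Function.update s.node i (s.node i - (1 / Q.sigmaT) •
          (gradient (Q.f i j) (Q.zStep pcomp s i j) - gradient (Q.f i j) (s.z i j)))
        token := s.token
        z := Function.update s.z i (Function.update (s.z i) j (Q.zStep pcomp s i j)) } := rfl

/-- A computation step leaves the dual variable `x` unchanged: the update of `θ^(i)` is built so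
that `σ̃ θ^(i) + ∑ⱼ ∇f_ij(z^(i,j))` is invariant. -/
lemma nodeRes_step_inr (hσ : Q.sigmaT ≠ 0) (i : Fin n) (j : Fin m) :
    Q.nodeRes θs (Q.step pcomp (.inr (i, j)) s) = Q.nodeRes θs s := by
  funext i'
  rw [step_inr]
  by_cases hi : i' = i
  · subst hi
    simp only [nodeRes, gradGap, Function.update_self]
    rw [sum_apply_update (fun j' x => gradient (Q.f i' j') x - gradient (Q.f i' j') θs)]
    rw [sub_right_comm, smul_sub, smul_smul, mul_one_div_cancel hσ, one_smul]
    abel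
  · simp [nodeRes, gradGap, hi]

lemma balanced_step_inr (hσ : Q.sigmaT ≠ 0) (i : Fin n) (j : Fin m) (hs : Q.Balanced θs s) :
    Q.Balanced θs (Q.step pcomp (.inr (i, j)) s) := by
  unfold Balanced at *
  rw [nodeRes_step_inr Q pcomp θs s hσ]
  exact hs

lemma balanced_step (hσ : Q.sigmaT ≠ 0) (e : Edge n m K) (hs : Q.Balanced θs s) :
    Q.Balanced θs (Q.step pcomp e s) := by
  rcases e with ⟨i, k⟩ | ⟨i, j⟩
  · exact Q.balanced_step_inl pcomp θs s i k hs
  · exact Q.balanced_step_inr pcomp θs s hσ i j hs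

lemma refDiv_step_inr (hσ : Q.sigmaT ≠ 0) (i : Fin n) (j : Fin m) :
    Q.refDiv θs (Q.step pcomp (.inr (i, j)) s) = Q.refDiv θs s + 1 / Q.alpha *
      (Q.rhoComp pcomp i j * inner ℝ (Q.gradGap θs s i j) (s.node i - s.z i j)
        + bregDiv (Q.f i j) (Q.zStep pcomp s i j) (s.z i j)) := by
  have h1 : Q.tokenRes θs (Q.step pcomp (.inr (i, j)) s) = Q.tokenRes θs s := rfl
  rw [refDiv, nodeRes_step_inr Q pcomp θs s hσ, h1]
  simp only [step_inr]
  rw [sum_sum_apply_update (fun i j x => bregDiv (Q.f i j) x θs), bregDiv_sub_left, zStep_sub,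
    real_inner_smul_right]
  unfold refDiv gradGap
  ring

lemma dualGap_step_inr (hσ : Q.sigmaT ≠ 0) (i : Fin n) (j : Fin m) :
    Q.dualGap θs (Q.step pcomp (.inr (i, j)) s) = Q.dualGap θs s
      - inner ℝ (gradient (Q.f i j) (Q.zStep pcomp s i j) - gradient (Q.f i j) (s.z i j))
          (s.node i - s.z i j)
      + bregDiv (Q.f i j) (s.z i j) (Q.zStep pcomp s i j)
      + ‖gradient (Q.f i j) (Q.zStep pcomp s i j) - gradient (Q.f i j) (s.z i j)‖ ^ 2
          / (2 * Q.sigmaT) := by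
  simp only [dualGap, State.sqDist, step_inr]
  rw [sum_sum_apply_update (fun i j x => bregDiv (Q.f i j) θs x), bregDiv_sub_right,
    sum_apply_update (fun _ x => ‖x - θs‖ ^ 2), sub_right_comm, norm_sub_sq_sub,
    norm_smul, mul_pow, Real.norm_eq_abs, sq_abs, real_inner_smul_right]
  set q := gradient (Q.f i j) (Q.zStep pcomp s i j) - gradient (Q.f i j) (s.z i j)
  have h : inner ℝ q (s.node i - s.z i j)
      = inner ℝ (s.node i - θs) q - inner ℝ q (s.z i j - θs) := by
    rw [real_inner_comm q (s.node i - θs), ← inner_sub_right, sub_sub_sub_cancel_right]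
  rw [h]
  field_simp
  ring

namespace Regular

variable {Q pcomp}

/-- As `z' - z = ρ (θ - z)`, the inner product in `dualGap_step_inr` is `1/ρ` times the symmetrized
divergence of `z'` and `z`. By cocoercivity the remaining terms are at most `(1 + L / σ̃) D(z, z')`,
which the `D(z, z')` half absorbs; the other half is the decrease. -/
lemma dualGap_step_inr_le (h : Q.Regular) (hp0 : 0 < pcomp) (hp1 : pcomp < 1)
    (i : Fin n) (j : Fin m) :
    Q.dualGap θs (Q.step pcomp (.inr (i, j)) s) ≤ Q.dualGap θs s
      - 1 / Q.rhoComp pcomp i j * bregDiv (Q.f i j) (Q.zStep pcomp s i j) (s.z i j) := by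
  have hσ := h.sigmaT_pos
  have hρ := h.rhoComp_pos hp0 hp1 i j
  have hρ1 := h.rhoComp_mul_le hp0 hp1 i j
  rw [dualGap_step_inr Q pcomp θs s hσ.ne']
  set z' := Q.zStep pcomp s i j with hz'
  have h1 := sq_norm_gradient_sub_le (h.convex i j) (h.diff i j) (h.L_pos i j) (h.smooth i j)
    (s.z i j) z'
  rw [norm_sub_rev] at h1
  have h2 := bregDiv_nonneg (h.convex i j) (h.diff i j) (s.z i j) z'
  have h3 := bregDiv_add_swap (Q.f i j) z' (s.z i j)
  rw [hz', zStep_sub, ← hz', real_inner_smul_right] at h3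
  set q := gradient (Q.f i j) z' - gradient (Q.f i j) (s.z i j)
  set D := bregDiv (Q.f i j) (s.z i j) z'
  set D' := bregDiv (Q.f i j) z' (s.z i j)
  have h4 : inner ℝ q (s.node i - s.z i j) = 1 / Q.rhoComp pcomp i j * (D' + D) := by
    rw [h3]
    field_simp
  have h5 : ‖q‖ ^ 2 / (2 * Q.sigmaT) ≤ Q.L i j / Q.sigmaT * D := by
    calc ‖q‖ ^ 2 / (2 * Q.sigmaT) ≤ (2 * Q.L i j * D) / (2 * Q.sigmaT) := by gcongr
      _ = _ := by field_simp
  have h6 : (1 + Q.L i j / Q.sigmaT) * D ≤ 1 / Q.rhoComp pcomp i j * D := by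
    gcongr
    rw [le_div_iff₀ hρ]
    linarith
  rw [h4]
  linarith

/-- `refDiv` pays `D(z', z) / α`. The dual gap returns `(η / R_p) D(z', z) / ρ = (p / R_p) D(z', z)
/ α`, which is enough since `R_p ≤ p`. -/
lemma lyapunov_step_inr_le (h : Q.Regular) (hp0 : 0 < pcomp) (hp1 : pcomp < 1)
    (i : Fin n) (j : Fin m) :
    Q.prob pcomp (.inr (i, j)) * Q.lyapunov pcomp θs (Q.step pcomp (.inr (i, j)) s)
      ≤ Q.prob pcomp (.inr (i, j)) * Q.lyapunov pcomp θs s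
        + Q.eta pcomp * inner ℝ (Q.gradGap θs s i j) (s.node i - s.z i j) := by
  have hσ := h.sigmaT_pos
  have hp := h.prob_pos hp0 hp1 (.inr (i, j))
  have hα := h.alpha_pos
  have hη := h.eta_pos hp0 hp1
  have hR := h.Rp_pos hp0 hp1
  have h1 := h.dualGap_step_inr_le θs s hp0 hp1 i j
  have h2 := bregDiv_nonneg (h.convex i j) (h.diff i j) (Q.zStep pcomp s i j) (s.z i j)
  have h3 : Q.Rp pcomp ≤ Q.prob pcomp (.inr (i, j)) := by
    simpa [h.R_inr] using Rp_le (Q := Q) (pcomp := pcomp) (.inr (i, j))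
  unfold lyapunov
  rw [refDiv_step_inr Q pcomp θs s hσ.ne']
  set D := bregDiv (Q.f i j) (Q.zStep pcomp s i j) (s.z i j)
  set I := inner ℝ (Q.gradGap θs s i j) (s.node i - s.z i j)
  set p := Q.prob pcomp (.inr (i, j)) with hpdef
  have h4 : Q.rhoComp pcomp i j = Q.alpha * Q.eta pcomp / p := rfl
  have h5 : Q.eta pcomp / Q.Rp pcomp * Q.dualGap θs (Q.step pcomp (.inr (i, j)) s)
      ≤ Q.eta pcomp / Q.Rp pcomp * Q.dualGap θs s - 1 / Q.alpha * D := by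
    calc _ ≤ Q.eta pcomp / Q.Rp pcomp * (Q.dualGap θs s - 1 / Q.rhoComp pcomp i j * D) := by
          gcongr
      _ = Q.eta pcomp / Q.Rp pcomp * Q.dualGap θs s - (p / Q.Rp pcomp) * (1 / Q.alpha * D) := by
          rw [h4]
          field_simp
      _ ≤ Q.eta pcomp / Q.Rp pcomp * Q.dualGap θs s - 1 * (1 / Q.alpha * D) := by
          gcongr
          exact (one_le_div hR).2 h3
      _ = _ := by ring
  have h6 : p * (1 / Q.alpha * (Q.rhoComp pcomp i j * I)) = Q.eta pcomp * I := by
    rw [h4]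
    field_simp
  have h7 := mul_le_mul_of_nonneg_left h5 hp.le
  rw [← h6]
  linarith

/-- The second-order term `R_e (η / p)² ‖u‖² / 2` of the energy is covered by the decrease of the
dual gap, because `1 - ρ_comm ≥ 1/2` and `R_p ≤ p / R_e`. -/
lemma lyapunov_step_inl_le (h : Q.Regular) (hp0 : 0 < pcomp) (hp1 : pcomp < 1)
    (i : Fin n) (k : Fin K) :
    Q.prob pcomp (.inl (i, k)) * Q.lyapunov pcomp θs (Q.step pcomp (.inl (i, k)) s)
      ≤ Q.prob pcomp (.inl (i, k)) * Q.lyapunov pcomp θs s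
        - Q.eta pcomp * inner ℝ ((1 / K : ℝ) • Q.nodeRes θs s i - (1 / n : ℝ) • Q.tokenRes θs s k
            - (1 / (n * K) : ℝ) • ∑ i, Q.nodeRes θs s i) (s.node i - s.token k) := by
  have hσ := h.sigmaT_pos
  have hp := h.prob_pos hp0 hp1 (.inl (i, k))
  have hη := h.eta_pos hp0 hp1
  have hR := h.Rp_pos hp0 hp1
  have hRe := h.R_pos (.inl (i, k))
  have h3 : Q.Rp pcomp ≤ Q.prob pcomp (.inl (i, k)) / Q.R (.inl (i, k)) := Rp_le _
  have hρ := h.rhoComm_le hp1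
  have hτ := h.sigmaT_mul_rhoComm hp1 (i, k)
  have hgap : Q.dualGap θs (Q.step pcomp (.inl (i, k)) s) = Q.dualGap θs s
      - Q.sigmaT * Q.rhoComm pcomp * (1 - Q.rhoComm pcomp) * ‖s.node i - s.token k‖ ^ 2 := by
    rw [dualGap, sqDist_step_inl]
    unfold dualGap
    simp only [step]
    ring
  have href : Q.refDiv θs (Q.step pcomp (.inl (i, k)) s) = Q.refDiv θs s
      + 1 / 2 * (energy (Q.nodeRes θs (Q.step pcomp (.inl (i, k)) s))
          (Q.tokenRes θs (Q.step pcomp (.inl (i, k)) s))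
        - energy (Q.nodeRes θs s) (Q.tokenRes θs s)) := by
    unfold refDiv
    simp only [step]
    ring
  unfold lyapunov
  rw [href, hgap, nodeRes_step_inl, tokenRes_step_inl, energy_update, real_inner_smul_right,
    ← h.R_inl (i, k), norm_smul, mul_pow, Real.norm_eq_abs, sq_abs, hτ]
  set I := inner ℝ ((1 / K : ℝ) • Q.nodeRes θs s i - (1 / n : ℝ) • Q.tokenRes θs s k
            - (1 / (n * K) : ℝ) • ∑ i, Q.nodeRes θs s i) (s.node i - s.token k)
  set p := Q.prob pcomp (.inl (i, k))
  set r := ‖s.node i - s.token k‖ ^ 2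
  have hr : 0 ≤ r := sq_nonneg _
  have h5 : 1 / 2 * (Q.R (.inl (i, k)) * ((Q.eta pcomp / p) ^ 2 * r))
      ≤ Q.eta pcomp / Q.Rp pcomp * (Q.eta pcomp / p * (1 - Q.rhoComm pcomp) * r) := by
    calc 1 / 2 * (Q.R (.inl (i, k)) * ((Q.eta pcomp / p) ^ 2 * r))
        = Q.eta pcomp / (p / Q.R (.inl (i, k))) * (Q.eta pcomp / p * (1 / 2) * r) := by
          field_simp
      _ ≤ _ := by
          gcongr
          linarith
  have h6 : p * (Q.eta pcomp / p * I) = Q.eta pcomp * I := by field_simp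
  have h7 := mul_le_mul_of_nonneg_left h5 hp.le
  rw [← h6]
  linarith

end Regular

end Problem

/-- A weighted Cauchy-Schwarz inequality. -/
lemma norm_sq_add_sum_le {E : Type*} [NormedAddCommGroup E] {ι : Type*} [Fintype ι] (u : E)
    (g : ι → E) {w : ℝ} (hw : 0 < w) {v : ι → ℝ} (hv : ∀ j, 0 < v j) :
    ‖u + ∑ j, g j‖ ^ 2 ≤ (w + ∑ j, v j) * (‖u‖ ^ 2 / w + ∑ j, ‖g j‖ ^ 2 / v j) := by
  have h1 : ‖u + ∑ j, g j‖ ≤ ‖u‖ + ∑ j, ‖g j‖ :=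
    (norm_add_le _ _).trans (by gcongr; exact norm_sum_le _ _)
  -- `Option ι` adjoins `u`, with weight `w`, to the family `g`.
  have h2 := Finset.sum_sq_le_sum_mul_sum_of_sq_le_mul (Finset.univ : Finset (Option ι))
    (r := fun o => o.elim ‖u‖ fun j => ‖g j‖) (f := fun o => o.elim w v)
    (g := fun o => o.elim (‖u‖ ^ 2 / w) fun j => ‖g j‖ ^ 2 / v j)
    (fun o _ => by cases o <;> simp [hw.le, (hv _).le])
    (fun o _ => by
      cases o with
      | none => simp only [Option.elim]; positivity
      | some j => have := hv j; simp only [Option.elim]; positivity)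
    (fun o _ => by
      cases o with
      | none => simp only [Option.elim]; field_simp; exact le_rfl
      | some j => have := hv j; simp only [Option.elim]; field_simp; exact le_rfl)
  simp only [Fintype.sum_option, Option.elim] at h2
  exact (pow_le_pow_left₀ (norm_nonneg _) h1 2).trans h2

/-! ### Expected one-step contraction -/

namespace Problem.Regular

variable {d n m K : ℕ} {Q : Problem d n m K} {pcomp : ℝ} (θs : Vec d) (s : State d n m K)

lemma sum_prob (h : Q.Regular) : ∑ e, Q.prob pcomp e = 1 := by
  have h1 := h.cast_n_pos
  have h2 := h.cast_K_pos
  have h3 : ∀ i, ∑ j, Q.prob pcomp (.inr (i, j)) = pcomp / n := fun i => by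
    have h4 := h.sum_one_add_L_div_pos i
    simp only [prob]
    rw [← Finset.mul_sum, ← Finset.sum_div, div_self h4.ne', mul_one]
  rw [Fintype.sum_sum_type, Fintype.sum_prod_type, Fintype.sum_prod_type]
  simp only [h3]
  simp only [prob, Finset.sum_const, Finset.card_univ, Fintype.card_fin, nsmul_eq_mul]
  field_simp
  ring

lemma sum_inner_nodeRes (s : State d n m K) :
    ∑ i, inner ℝ (Q.nodeRes θs s i) (s.node i - θs)
      + ∑ k, inner ℝ (Q.tokenRes θs s k) (s.token k - θs)
      = Q.sigmaT * s.sqDist θs + ∑ i, ∑ j, inner ℝ (Q.gradGap θs s i j) (s.node i - θs) := by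
  simp only [nodeRes, tokenRes, inner_add_left, real_inner_smul_left, sum_inner,
    real_inner_self_eq_norm_sq, Finset.sum_add_distrib, State.sqDist, mul_add, Finset.mul_sum]
  ring

/-- One-step decrease of the Lyapunov function in expectation. -/
lemma sum_prob_mul_lyapunov_le (h : Q.Regular) (hp0 : 0 < pcomp) (hp1 : pcomp < 1)
    (hs : Q.Balanced θs s) :
    ∑ e, Q.prob pcomp e * Q.lyapunov pcomp θs (Q.step pcomp e s) ≤ Q.lyapunov pcomp θs s
      - Q.eta pcomp * (Q.sigmaT * s.sqDist θs + ∑ i, ∑ j, bregDiv (Q.f i j) (s.z i j) θs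
        + ∑ i, ∑ j, bregDiv (Q.f i j) θs (s.z i j)) := by
  have hsum := h.sum_prob (pcomp := pcomp)
  have h1 := sum_inner_edge h.n_pos h.one_le_K (Q.nodeRes θs s) (fun i => s.node i - θs)
    (Q.tokenRes θs s) (fun k => s.token k - θs) hs
  simp only [sub_sub_sub_cancel_right] at h1
  rw [sum_inner_nodeRes] at h1
  -- Communication edges pair the gradient gap with `θ^(i) - θ⋆`, computation edges with `θ^(i) -
  -- z^(i,j)`. In the difference `θ^(i)` cancels, and `z^(i,j) - θ⋆` yields the symmetrized
  -- divergence.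
  have h2 : ∑ i, ∑ j, inner ℝ (Q.gradGap θs s i j) (s.node i - θs)
      - ∑ i, ∑ j, inner ℝ (Q.gradGap θs s i j) (s.node i - s.z i j)
      = ∑ i, ∑ j, bregDiv (Q.f i j) (s.z i j) θs + ∑ i, ∑ j, bregDiv (Q.f i j) θs (s.z i j) := by
    simp only [← Finset.sum_sub_distrib, ← Finset.sum_add_distrib, bregDiv_add_swap,
      ← inner_sub_right, sub_sub_sub_cancel_left]
    rfl
  have h3 : Q.lyapunov pcomp θs s = ∑ e, Q.prob pcomp e * Q.lyapunov pcomp θs s := by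
    rw [← Finset.sum_mul, hsum, one_mul]
  rw [add_assoc, ← h2, h3, Fintype.sum_sum_type, Fintype.sum_sum_type, Fintype.sum_prod_type,
    Fintype.sum_prod_type, Fintype.sum_prod_type, Fintype.sum_prod_type]
  have h4 := Finset.sum_le_sum fun i (_ : i ∈ Finset.univ) =>
    Finset.sum_le_sum fun k (_ : k ∈ Finset.univ) => h.lyapunov_step_inl_le θs s hp0 hp1 i k
  have h5 := Finset.sum_le_sum fun i (_ : i ∈ Finset.univ) =>
    Finset.sum_le_sum fun j (_ : j ∈ Finset.univ) => h.lyapunov_step_inr_le θs s hp0 hp1 i j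
  simp only [Finset.sum_sub_distrib, ← Finset.mul_sum, h1] at h4
  simp only [Finset.sum_add_distrib, ← Finset.mul_sum] at h5
  linarith

/-- Cauchy-Schwarz at each center, with weight `w` on the parameter and `L_ij / σ̃` on the gradient
gaps; the total weight is at most `w + κ_s - 1`. The free `w` is tuned in `rate_mul_lyapunov_le`. -/
lemma energy_res_le (h : Q.Regular) {w : ℝ} (hw : 0 < w) :
    energy (Q.nodeRes θs s) (Q.tokenRes θs s) ≤ (w + Q.kappaS - 1) / K * Q.sigmaT *
      (Q.sigmaT * s.sqDist θs / w + ∑ i, ∑ j, ‖Q.gradGap θs s i j‖ ^ 2 / Q.L i j) := by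
  have hσ := h.sigmaT_pos
  have hK := h.cast_K_pos
  have hκ := h.one_le_kappaS
  have h1 : ∀ i, ‖Q.nodeRes θs s i‖ ^ 2 ≤ (w + Q.kappaS - 1) * (Q.sigmaT ^ 2 *
      ‖s.node i - θs‖ ^ 2 / w + Q.sigmaT * ∑ j, ‖Q.gradGap θs s i j‖ ^ 2 / Q.L i j) := fun i => by
    refine (norm_sq_add_sum_le _ _ hw (v := fun j => Q.L i j / Q.sigmaT)
      (fun j => div_pos (h.L_pos i j) hσ)).trans ?_
    have h2 := le_kappaS (Q := Q) i
    have h3 : ∑ j, ‖Q.gradGap θs s i j‖ ^ 2 / (Q.L i j / Q.sigmaT)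
        = Q.sigmaT * ∑ j, ‖Q.gradGap θs s i j‖ ^ 2 / Q.L i j := by
      rw [Finset.mul_sum]
      exact Finset.sum_congr rfl fun j _ => by rw [div_div_eq_mul_div]; ring
    have h4 : 0 ≤ ∑ j, ‖Q.gradGap θs s i j‖ ^ 2 / Q.L i j :=
      Finset.sum_nonneg fun j _ => div_nonneg (sq_nonneg _) (h.L_pos i j).le
    rw [h3, norm_smul, mul_pow, Real.norm_eq_abs, sq_abs]
    gcongr
    linarith
  have h2 : ∀ k, ‖Q.tokenRes θs s k‖ ^ 2 ≤ (w + Q.kappaS - 1) * (Q.sigmaT ^ 2 *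
      ‖s.token k - θs‖ ^ 2 / w) := fun k => by
    rw [tokenRes, norm_smul, mul_pow, Real.norm_eq_abs, sq_abs]
    calc Q.sigmaT ^ 2 * ‖s.token k - θs‖ ^ 2
        = w * (Q.sigmaT ^ 2 * ‖s.token k - θs‖ ^ 2 / w) := by field_simp
      _ ≤ _ := by gcongr; linarith
  refine (energy_le h.one_le_K h.K_le_n _ _).trans ?_
  rw [div_le_iff₀ hK]
  refine (add_le_add (Finset.sum_le_sum fun i _ => h1 i)
    (Finset.sum_le_sum fun k _ => h2 k)).trans (le_of_eq ?_)
  simp only [← Finset.mul_sum, Finset.sum_add_distrib, ← Finset.sum_div, State.sqDist]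
  field_simp
  ring

/-- Relative strong convexity. -/
lemma rate_mul_lyapunov_le (h : Q.Regular) (hp0 : 0 < pcomp) (hp1 : pcomp < 1) :
    K / (Q.sigmaT * Q.kappaS) * Q.lyapunov pcomp θs s ≤ Q.sigmaT * s.sqDist θs
      + ∑ i, ∑ j, bregDiv (Q.f i j) (s.z i j) θs + ∑ i, ∑ j, bregDiv (Q.f i j) θs (s.z i j) := by
  have hσ := h.sigmaT_pos
  have hK := h.cast_K_pos
  have hκ := h.one_le_kappaS
  have hκ0 := h.kappaS_pos
  have hα := h.alpha_pos
  have hE := fun w (hw : 0 < w) => h.energy_res_le θs s hw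
  have hG1 : ∑ i, ∑ j, ‖Q.gradGap θs s i j‖ ^ 2 / Q.L i j
      ≤ 2 * ∑ i, ∑ j, bregDiv (Q.f i j) (s.z i j) θs := by
    simp only [Finset.mul_sum]
    refine Finset.sum_le_sum fun i _ => Finset.sum_le_sum fun j _ => ?_
    rw [div_le_iff₀ (h.L_pos i j)]
    have := sq_norm_gradient_sub_le (h.convex i j) (h.diff i j) (h.L_pos i j) (h.smooth i j)
      (s.z i j) θs
    unfold gradGap
    linarith
  have hG2 : ∑ i, ∑ j, ‖Q.gradGap θs s i j‖ ^ 2 / Q.L i j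
      ≤ 2 * ∑ i, ∑ j, bregDiv (Q.f i j) θs (s.z i j) := by
    simp only [Finset.mul_sum]
    refine Finset.sum_le_sum fun i _ => Finset.sum_le_sum fun j _ => ?_
    rw [div_le_iff₀ (h.L_pos i j)]
    have := sq_norm_gradient_sub_le (h.convex i j) (h.diff i j) (h.L_pos i j) (h.smooth i j)
      θs (s.z i j)
    rw [norm_sub_rev] at this
    unfold gradGap
    linarith
  have hD1 : 0 ≤ ∑ i, ∑ j, bregDiv (Q.f i j) (s.z i j) θs := Finset.sum_nonneg fun i _ =>
    Finset.sum_nonneg fun j _ => bregDiv_nonneg (h.convex i j) (h.diff i j) _ _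
  have hD2 : 0 ≤ ∑ i, ∑ j, bregDiv (Q.f i j) θs (s.z i j) := Finset.sum_nonneg fun i _ =>
    Finset.sum_nonneg fun j _ => bregDiv_nonneg (h.convex i j) (h.diff i j) _ _
  have hX : 0 ≤ Q.sigmaT * s.sqDist θs := by unfold State.sqDist; positivity
  have hβ := h.rate_div_Rp_le hp0 hp1
  set β := K / (Q.sigmaT * Q.kappaS) * (Q.eta pcomp / Q.Rp pcomp) with hβdef
  have hexp : K / (Q.sigmaT * Q.kappaS) * Q.lyapunov pcomp θs s
      = K / (Q.sigmaT * Q.kappaS) / 2 * energy (Q.nodeRes θs s) (Q.tokenRes θs s)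
        + 1 / 2 * ∑ i, ∑ j, bregDiv (Q.f i j) (s.z i j) θs
        + β * (1 / 2 * (Q.sigmaT * s.sqDist θs) + ∑ i, ∑ j, bregDiv (Q.f i j) θs (s.z i j)) := by
    have : 1 / Q.alpha = Q.sigmaT * Q.kappaS / (2 * K) := by unfold alpha; field_simp
    unfold lyapunov refDiv dualGap
    rw [hβdef, this]
    field_simp
  rw [hexp]
  set X := Q.sigmaT * s.sqDist θs
  set G := ∑ i, ∑ j, ‖Q.gradGap θs s i j‖ ^ 2 / Q.L i j
  set D1 := ∑ i, ∑ j, bregDiv (Q.f i j) (s.z i j) θs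
  set D2 := ∑ i, ∑ j, bregDiv (Q.f i j) θs (s.z i j)
  -- The last two conditions on `w` compare the coefficients of `D2` and of `X` on both sides.
  have key : ∀ w, 0 < w → 1 / 2 ≤ (w + Q.kappaS - 1) / Q.kappaS →
      (w + Q.kappaS - 1) / Q.kappaS - 1 / 2 + β ≤ 1 →
      (w + Q.kappaS - 1) / Q.kappaS / w + β ≤ 2 →
      K / (Q.sigmaT * Q.kappaS) / 2 * energy (Q.nodeRes θs s) (Q.tokenRes θs s) + 1 / 2 * D1
        + β * (1 / 2 * X + D2) ≤ X + D1 + D2 := by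
    intro w hw ht h1 h2
    have h3 : K / (Q.sigmaT * Q.kappaS) / 2 * energy (Q.nodeRes θs s) (Q.tokenRes θs s)
        ≤ 1 / 2 * ((w + Q.kappaS - 1) / Q.kappaS / w) * X
          + 1 / 2 * ((w + Q.kappaS - 1) / Q.kappaS) * G := by
      calc _ ≤ K / (Q.sigmaT * Q.kappaS) / 2 * ((w + Q.kappaS - 1) / K * Q.sigmaT * (X / w + G)) := by
            gcongr
            exact hE w hw
        _ = _ := by field_simp
    set t := (w + Q.kappaS - 1) / Q.kappaS
    -- A share `1/2` of `G` is charged to `D1`, which exhausts its coefficient, and the rest `t -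
    -- 1/2` to `D2`.
    have h4 : t * G ≤ D1 + (2 * t - 1) * D2 := by nlinarith
    nlinarith [mul_le_mul_of_nonneg_right h1 hD2, mul_le_mul_of_nonneg_right h2 hX]
  -- `w = 1` suffices if `β ≤ 1/2`. If only `β ≤ 1 / κ_s` is known, `w = 1/2` makes the coefficient
  -- of `X` at most `(2 - 1 / κ_s) + 1 / κ_s`, with no slack.
  rcases hβ with hβ | hβ
  · have e1 : (1 + Q.kappaS - 1) / Q.kappaS = 1 := by
      rw [add_sub_cancel_left, div_self hκ0.ne']
    refine key 1 one_pos ?_ ?_ ?_ <;> rw [e1] <;> linarith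
  · have h1 : 1 / Q.kappaS ≤ 1 := (div_le_one hκ0).2 hκ
    have e1 : (1 / 2 + Q.kappaS - 1) / Q.kappaS = 1 - 1 / 2 * (1 / Q.kappaS) := by
      field_simp
      ring
    refine key (1 / 2) (by norm_num) ?_ ?_ ?_ <;> rw [e1] <;> linarith

lemma sum_prob_mul_lyapunov_le_rate (h : Q.Regular) (hp0 : 0 < pcomp) (hp1 : pcomp < 1)
    (hs : Q.Balanced θs s) :
    ∑ e, Q.prob pcomp e * Q.lyapunov pcomp θs (Q.step pcomp e s)
      ≤ (1 - Q.eta pcomp * K / (Q.sigmaT * Q.kappaS)) * Q.lyapunov pcomp θs s := by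
  refine (h.sum_prob_mul_lyapunov_le θs s hp0 hp1 hs).trans ?_
  have h1 := mul_le_mul_of_nonneg_left (h.rate_mul_lyapunov_le θs s hp0 hp1)
    (h.eta_pos hp0 hp1).le
  rw [← mul_assoc, ← mul_div_assoc] at h1
  linarith

lemma refDiv_nonneg (h : Q.Regular) : 0 ≤ Q.refDiv θs s := by
  have hα := h.alpha_pos
  have h1 := energy_nonneg h.n_pos (Q.nodeRes θs s) (Q.tokenRes θs s)
  have hD1 : 0 ≤ ∑ i, ∑ j, bregDiv (Q.f i j) (s.z i j) θs := Finset.sum_nonneg fun i _ =>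
    Finset.sum_nonneg fun j _ => bregDiv_nonneg (h.convex i j) (h.diff i j) _ _
  unfold refDiv
  positivity

lemma sqDist_le_lyapunov (h : Q.Regular) (hp0 : 0 < pcomp) (hp1 : pcomp < 1) :
    s.sqDist θs ≤ 2 * Q.Rp pcomp / (Q.sigmaT * Q.eta pcomp) * Q.lyapunov pcomp θs s := by
  have hσ := h.sigmaT_pos
  have hη := h.eta_pos hp0 hp1
  have hR := h.Rp_pos hp0 hp1
  have h1 := h.refDiv_nonneg θs s
  have hD2 : 0 ≤ ∑ i, ∑ j, bregDiv (Q.f i j) θs (s.z i j) := Finset.sum_nonneg fun i _ =>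
    Finset.sum_nonneg fun j _ => bregDiv_nonneg (h.convex i j) (h.diff i j) _ _
  have h2 : Q.eta pcomp / Q.Rp pcomp * (Q.sigmaT / 2 * s.sqDist θs) ≤ Q.lyapunov pcomp θs s := by
    have h3 : Q.eta pcomp / Q.Rp pcomp * (Q.sigmaT / 2 * s.sqDist θs)
        ≤ Q.eta pcomp / Q.Rp pcomp * Q.dualGap θs s := by
      unfold dualGap
      gcongr
      linarith
    unfold lyapunov
    linarith
  calc s.sqDist θs = 2 * Q.Rp pcomp / (Q.sigmaT * Q.eta pcomp)
        * (Q.eta pcomp / Q.Rp pcomp * (Q.sigmaT / 2 * s.sqDist θs)) := by field_simp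
    _ ≤ _ := by gcongr

end Problem.Regular

lemma coe_sum_ereal {ι : Type*} (s : Finset ι) (G : ι → ℝ) :
    ((∑ i ∈ s, G i : ℝ) : EReal) = ∑ i ∈ s, (G i : EReal) :=
  map_sum (⟨⟨fun x : ℝ => (x : EReal), EReal.coe_zero⟩, EReal.coe_add⟩ : ℝ →+ EReal) G s

/-! ### Strong duality and the dual minimizers -/

namespace Problem

variable {d n m K : ℕ} (Q : Problem d n m K) (w : Edge n m K → Vec d)

lemma act_comp (i : Fin n) (j : Fin m) :
    act Q.incidence w (.inl (i, j)) = Q.weight (.inr (i, j)) • w (.inr (i, j)) :=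
  Q.incidence_comp w i j

lemma act_center (i : Fin n) :
    act Q.incidence w (.inr (.inl i))
      = ∑ k, w (.inl (i, k)) - ∑ j, Q.weight (.inr (i, j)) • w (.inr (i, j)) :=
  Q.incidence_center w i

lemma act_token (k : Fin K) :
    act Q.incidence w (.inr (.inr k)) = -∑ i, w (.inl (i, k)) :=
  Q.incidence_token w k

lemma sum_act_inr :
    ∑ v, act Q.incidence w (.inr v) = -∑ i, ∑ j, act Q.incidence w (.inl (i, j)) := by
  simp only [Fintype.sum_sum_type, act_comp, act_center, act_token, Finset.sum_sub_distrib,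
    Finset.sum_neg_distrib]
  rw [Finset.sum_comm]
  abel

/-- Evaluating the conjugates at arbitrary points bounds the dual objective from below. -/
lemma le_dualObj (θ : Fin n → Fin m → Vec d) :
    ((Q.dualQuad w + ∑ i, ∑ j, (inner ℝ (act Q.incidence w (.inl (i, j))) (θ i j)
      - Q.f i j (θ i j)) : ℝ) : EReal) ≤ Q.dualObj w := by
  rw [EReal.coe_add, coe_sum_ereal]
  simp only [coe_sum_ereal]
  unfold dualObj
  gcongr
  exact le_conj _ _ _

lemma dualObj_eq (hc : ∀ i j, ConvexOn ℝ Set.univ (Q.f i j))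
    (hd : ∀ i j, Differentiable ℝ (Q.f i j)) (z : Fin n → Fin m → Vec d)
    (hz : ∀ i j, Q.weight (.inr (i, j)) • w (.inr (i, j)) = gradient (Q.f i j) (z i j)) :
    Q.dualObj w = ((Q.dualQuad w + ∑ i, ∑ j,
      (inner ℝ (act Q.incidence w (.inl (i, j))) (z i j) - Q.f i j (z i j)) : ℝ) : EReal) := by
  rw [EReal.coe_add, coe_sum_ereal]
  unfold dualObj
  simp only [coe_sum_ereal, act_comp, hz, conj_gradient (hc _ _) (hd _ _)]

namespace Regular

variable {Q}

/-- Completion of the square: the components of `A w` over all nodes sum to zero, and `(n + K) σ̃ =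
n σ` spreads the regularization evenly over centers and tokens. The squares left over measure
suboptimality. -/
lemma dualQuad_add (h : Q.Regular) (θs : Vec d) :
    Q.dualQuad w + ∑ i, ∑ j, (inner ℝ (act Q.incidence w (.inl (i, j))) θs - Q.f i j θs)
      = -Q.objective θs + 1 / (2 * Q.sigmaT) *
        ∑ v : Fin n ⊕ Fin K, ‖act Q.incidence w (.inr v) - Q.sigmaT • θs‖ ^ 2 := by
  have hσ := h.sigmaT_pos
  have h1 := h.cast_n_pos
  have h0 : (0 : ℝ) < n + K := by positivity
  have hσ' : (n + K) * Q.sigmaT = n * Q.σ := by unfold sigmaT; field_simp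
  have h2 : ∑ i, ∑ j, inner ℝ (act Q.incidence w (.inl (i, j))) θs
      = -∑ v : Fin n ⊕ Fin K, inner ℝ (act Q.incidence w (.inr v)) θs := by
    rw [← sum_inner, sum_act_inr, inner_neg_left, neg_neg]
    simp only [sum_inner]
  simp only [Finset.sum_sub_distrib, h2, norm_sub_sq_real, real_inner_smul_right, norm_smul,
    mul_pow, Real.norm_eq_abs, sq_abs, Finset.sum_add_distrib, ← Finset.mul_sum, objective,
    Finset.sum_const, Finset.card_univ, Fintype.card_sum, Fintype.card_fin, nsmul_eq_mul,
    Nat.cast_add, dualQuad]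
  have h3 : Q.σ / 2 * (n * ‖θs‖ ^ 2) = (n + K) * Q.sigmaT / 2 * ‖θs‖ ^ 2 := by
    rw [hσ']
    ring
  rw [h3]
  field_simp
  ring

lemma stationary (h : Q.Regular) {θs : Vec d} (hθs : ∀ θ, Q.objective θs ≤ Q.objective θ) :
    ∑ i, ∑ j, gradient (Q.f i j) θs + ((n + K) * Q.sigmaT) • θs = 0 := by
  have h1 := h.cast_n_pos
  have h0 : (0 : ℝ) < n + K := by positivity
  have hσ' : (n + K) * Q.sigmaT = n * Q.σ := by unfold sigmaT; field_simp
  refine ext_inner_right ℝ fun v => ?_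
  have hd : HasDerivAt (fun t : ℝ => Q.objective (θs + t • v))
      (∑ i : Fin n, ((∑ j, inner ℝ (gradient (Q.f i j) (θs + (0 : ℝ) • v)) v)
        + Q.σ / 2 * (2 * inner ℝ (θs + (0 : ℝ) • v) v))) 0 := by
    have hv : HasDerivAt (fun s : ℝ => θs + s • v) v 0 := by
      simpa using ((hasDerivAt_id (0 : ℝ)).smul_const v).const_add θs
    refine HasDerivAt.fun_sum fun i _ => HasDerivAt.add (HasDerivAt.fun_sum fun j _ => ?_) ?_
    · exact hasDerivAt_comp_line (h.diff i j) θs v 0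
    · exact hv.norm_sq.const_mul _
  have hmin : IsLocalMin (fun t : ℝ => Q.objective (θs + t • v)) 0 :=
    Filter.Eventually.of_forall fun t => by simpa using hθs _
  have h2 := hmin.hasDerivAt_eq_zero hd
  simp only [zero_smul, add_zero, Finset.sum_add_distrib, Finset.sum_const, Finset.card_univ,
    Fintype.card_fin, nsmul_eq_mul] at h2
  simp only [inner_add_left, sum_inner, real_inner_smul_left, inner_zero_left, hσ']
  linarith

lemma neg_objective_le (h : Q.Regular) (θs : Vec d) :
    ((-Q.objective θs + 1 / (2 * Q.sigmaT) *
      ∑ v : Fin n ⊕ Fin K, ‖act Q.incidence w (.inr v) - Q.sigmaT • θs‖ ^ 2 : ℝ) : EReal)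
      ≤ Q.dualObj w := by
  rw [← h.dualQuad_add]
  exact Q.le_dualObj w fun _ _ => θs

/-- Strong duality: the dual objective attains the opposite of the optimal primal value. -/
lemma exists_dualObj_eq (h : Q.Regular) {θs : Vec d}
    (hθs : ∀ θ, Q.objective θs ≤ Q.objective θ) :
    ∃ w, Q.dualObj w = ((-Q.objective θs : ℝ) : EReal) := by
  have hK := h.cast_K_pos
  have hst := h.stationary hθs
  -- Each center splits its surplus `σ̃ θ⋆ + ∑ⱼ ∇f_ij(θ⋆)` evenly among the `K` tokens; the token
  -- equations then reduce to stationarity of `θ⋆`.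
  let w : Edge n m K → Vec d
    | .inl (i, _) => (1 / K : ℝ) • (Q.sigmaT • θs + ∑ j, gradient (Q.f i j) θs)
    | .inr (i, j) => (Q.weight (.inr (i, j)))⁻¹ • gradient (Q.f i j) θs
  have hw : ∀ i j, Q.weight (.inr (i, j)) • w (.inr (i, j)) = gradient (Q.f i j) θs :=
    fun i j => smul_inv_smul₀ (h.weight_pos i j).ne' _
  refine ⟨w, ?_⟩
  rw [Q.dualObj_eq w h.convex h.diff (fun _ _ => θs) hw, h.dualQuad_add]
  have h0 : ∀ v : Fin n ⊕ Fin K, act Q.incidence w (.inr v) = Q.sigmaT • θs := by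
    rintro (i | k)
    · rw [act_center]
      simp only [hw]
      simp only [w, Finset.sum_const, Finset.card_univ, Fintype.card_fin]
      rw [← Nat.cast_smul_eq_nsmul ℝ, smul_smul, mul_one_div_cancel hK.ne', one_smul,
        add_sub_cancel_right]
    · rw [act_token]
      simp only [w]
      rw [← Finset.smul_sum, Finset.sum_add_distrib, eq_neg_of_add_eq_zero_left hst,
        Finset.sum_const, Finset.card_univ, Fintype.card_fin, ← Nat.cast_smul_eq_nsmul ℝ]
      rw [← sub_eq_zero]
      have : (1 / K : ℝ) * K = 1 := by field_simp
      calc _ = ((1 / K : ℝ) * K - 1) • (Q.sigmaT • θs) := by module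
        _ = 0 := by rw [this, sub_self, zero_smul]
  simp [h0]

lemma exists_isDualOpt (h : Q.Regular) {θs : Vec d}
    (hθs : ∀ θ, Q.objective θs ≤ Q.objective θ) : ∃ w, Q.IsDualOpt w := by
  obtain ⟨w, hw⟩ := h.exists_dualObj_eq hθs
  refine ⟨w, fun w' => ?_⟩
  rw [hw]
  refine le_trans ?_ (h.neg_objective_le w' θs)
  rw [EReal.coe_le_coe_iff]
  have := h.sigmaT_pos
  have : 0 ≤ 1 / (2 * Q.sigmaT) *
    ∑ v : Fin n ⊕ Fin K, ‖act Q.incidence w' (.inr v) - Q.sigmaT • θs‖ ^ 2 := by positivity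
  linarith

variable {w}

lemma dualObj_le (h : Q.Regular) {θs : Vec d}
    (hθs : ∀ θ, Q.objective θs ≤ Q.objective θ) (hw : Q.IsDualOpt w) :
    Q.dualObj w ≤ ((-Q.objective θs : ℝ) : EReal) := by
  obtain ⟨w', hw'⟩ := h.exists_dualObj_eq hθs
  exact hw' ▸ hw w'

/-- The optimal value is at most `-objective θ⋆`, while the lower bound exceeds this by the squares,
which must therefore vanish. -/
lemma act_inr_of_isDualOpt (h : Q.Regular) {θs : Vec d}
    (hθs : ∀ θ, Q.objective θs ≤ Q.objective θ) (hw : Q.IsDualOpt w) (v : Fin n ⊕ Fin K) :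
    act Q.incidence w (.inr v) = Q.sigmaT • θs := by
  have hσ := h.sigmaT_pos
  have h1 := (h.neg_objective_le w θs).trans (h.dualObj_le hθs hw)
  rw [EReal.coe_le_coe_iff] at h1
  have h2 : ∑ v : Fin n ⊕ Fin K, ‖act Q.incidence w (.inr v) - Q.sigmaT • θs‖ ^ 2 ≤ 0 := by
    by_contra hlt
    have : 0 < 1 / (2 * Q.sigmaT) *
        ∑ v : Fin n ⊕ Fin K, ‖act Q.incidence w (.inr v) - Q.sigmaT • θs‖ ^ 2 :=
      mul_pos (by positivity) (not_le.1 hlt)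
    linarith
  have h3 := (Finset.single_le_sum (f := fun v : Fin n ⊕ Fin K =>
    ‖act Q.incidence w (.inr v) - Q.sigmaT • θs‖ ^ 2) (fun _ _ => sq_nonneg _)
    (Finset.mem_univ v)).trans h2
  exact sub_eq_zero.1 (norm_eq_zero.1 (pow_eq_zero_iff two_ne_zero |>.1
    (le_antisymm h3 (sq_nonneg _))))

/-- Testing the conjugate of one `f_ij` at `θ'` and all others at `θ⋆` leaves the subgradient
inequality of `f_ij` at `θ⋆`. -/
lemma weight_smul_of_isDualOpt (h : Q.Regular) {θs : Vec d}
    (hθs : ∀ θ, Q.objective θs ≤ Q.objective θ) (hw : Q.IsDualOpt w) (i : Fin n) (j : Fin m) :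
    Q.weight (.inr (i, j)) • w (.inr (i, j)) = gradient (Q.f i j) θs := by
  refine (gradient_eq_of_forall_le (h.diff i j) fun θ' => ?_).symm
  have h1 := (Q.le_dualObj w (Function.update (fun _ _ => θs) i
    (Function.update (fun _ => θs) j θ'))).trans (h.dualObj_le hθs hw)
  rw [EReal.coe_le_coe_iff, sum_sum_apply_update (fun i j x =>
    inner ℝ (act Q.incidence w (.inl (i, j))) x - Q.f i j x) (fun _ _ => θs) i j θ', ← add_assoc,
    h.dualQuad_add, act_comp] at h1
  simp only [h.act_inr_of_isDualOpt hθs hw, sub_self, norm_zero] at h1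
  rw [inner_sub_right]
  simp at h1
  linarith

lemma dualObj_of_isDualOpt (h : Q.Regular) {θs : Vec d}
    (hθs : ∀ θ, Q.objective θs ≤ Q.objective θ) (hw : Q.IsDualOpt w) :
    Q.dualObj w = ((-Q.objective θs : ℝ) : EReal) := by
  rw [Q.dualObj_eq w h.convex h.diff (fun _ _ => θs) (h.weight_smul_of_isDualOpt hθs hw),
    h.dualQuad_add]
  simp [h.act_inr_of_isDualOpt hθs hw]

end Regular

end Problem

/-! ### The initial Lyapunov function in primal terms -/

lemma sum_inner_commProj {E : Type*} [NormedAddCommGroup E] [InnerProductSpace ℝ E] {n K : ℕ}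
    (x : Fin n × Fin K → E) :
    ∑ e, inner ℝ (x e) (∑ e', commProj e e' • x e')
      = energy (fun i => ∑ k, x (i, k)) (fun k => ∑ i, x (i, k)) := by
  have h1 : ∑ i, ∑ k, inner ℝ (x (i, k)) (∑ k', x (i, k'))
      = ∑ i, ‖∑ k, x (i, k)‖ ^ 2 := by
    simp only [← sum_inner, real_inner_self_eq_norm_sq]
  have h2 : ∑ i, ∑ k, inner ℝ (x (i, k)) (∑ i', x (i', k))
      = ∑ k, ‖∑ i, x (i, k)‖ ^ 2 := by
    rw [Finset.sum_comm]
    simp only [← sum_inner, real_inner_self_eq_norm_sq]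
  have h3 : ∑ i, ∑ k, inner ℝ (x (i, k)) (∑ i', ∑ k', x (i', k'))
      = ‖∑ i, ∑ k, x (i, k)‖ ^ 2 := by
    simp only [← sum_inner, real_inner_self_eq_norm_sq]
  rw [Fintype.sum_prod_type]
  simp only [commProj_sum, inner_add_right, inner_sub_right, real_inner_smul_right,
    Finset.sum_add_distrib, Finset.sum_sub_distrib, ← Finset.mul_sum, h1, h2, h3, energy]
  ring

namespace Problem.Regular

variable {d n m K : ℕ} {Q : Problem d n m K} {θs : Vec d} {w : Edge n m K → Vec d}

lemma sum_inl_of_isDualOpt (h : Q.Regular) (hθs : ∀ θ, Q.objective θs ≤ Q.objective θ)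
    (hw : Q.IsDualOpt w) (z₀ : Fin n → Fin m → Vec d) (i : Fin n) :
    ∑ k, w (.inl (i, k)) = -Q.nodeRes θs (Q.init z₀) i := by
  have h1 := h.act_inr_of_isDualOpt hθs hw (.inl i)
  rw [act_center] at h1
  simp only [h.weight_smul_of_isDualOpt hθs hw] at h1
  rw [sub_eq_iff_eq_add.1 h1]
  simp only [nodeRes, gradGap, init, Finset.sum_sub_distrib, smul_sub, smul_neg, smul_smul,
    mul_one_div_cancel h.sigmaT_pos.ne', one_smul]
  abel

lemma sum_inr_of_isDualOpt (h : Q.Regular) (hθs : ∀ θ, Q.objective θs ≤ Q.objective θ)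
    (hw : Q.IsDualOpt w) (z₀ : Fin n → Fin m → Vec d) (k : Fin K) :
    ∑ i, w (.inl (i, k)) = Q.tokenRes θs (Q.init z₀) k := by
  have h1 := h.act_inr_of_isDualOpt hθs hw (.inr k)
  rw [act_token] at h1
  rw [← neg_neg (∑ i, w (.inl (i, k))), h1]
  simp [tokenRes, init]

/-- Up to sign, the residuals are the row sums and the column sums of one array, the communication
part of a dual minimizer. -/
lemma balanced_init (h : Q.Regular) (hθs : ∀ θ, Q.objective θs ≤ Q.objective θ)
    (z₀ : Fin n → Fin m → Vec d) : Q.Balanced θs (Q.init z₀) := by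
  obtain ⟨w, hw⟩ := h.exists_isDualOpt hθs
  unfold Balanced
  simp only [← h.sum_inr_of_isDualOpt hθs hw z₀, ← neg_eq_iff_eq_neg.2
    (h.sum_inl_of_isDualOpt hθs hw z₀ _), Finset.sum_neg_distrib]
  rw [Finset.sum_comm, neg_add_cancel]

/-- The weights make every coefficient `L_ij / μ_ij²` equal to `1 / α`, and conjugation swaps the
arguments: the divergence of `f*` from `∇f(z₀)` to `∇f(θ⋆)` is that of `f` between `z₀` and `θ⋆`. -/
lemma bregman_eq (h : Q.Regular) (hθs : ∀ θ, Q.objective θs ≤ Q.objective θ)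
    (hw : Q.IsDualOpt w) (z₀ : Fin n → Fin m → Vec d) :
    bregman Q.refFun (Q.refGradInit z₀) w (Q.dualInit z₀) = Q.refDiv θs (Q.init z₀) := by
  have hα := h.alpha_pos
  have hcoef : ∀ i j, Q.L i j / Q.weight (.inr (i, j)) ^ 2 = 1 / Q.alpha := fun i j => by
    have := h.L_pos i j
    rw [h.weight_sq]
    field_simp
  have hw0 : ∀ i j, Q.weight (.inr (i, j)) • Q.dualInit z₀ (.inr (i, j))
      = gradient (Q.f i j) (z₀ i j) := fun i j => smul_inv_smul₀ (h.weight_pos i j).ne' _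
  have hlin : ∀ i j, inner ℝ (Q.refGradInit z₀ (.inr (i, j)))
      (w (.inr (i, j)) - Q.dualInit z₀ (.inr (i, j)))
      = 1 / Q.alpha * inner ℝ (z₀ i j) (gradient (Q.f i j) θs - gradient (Q.f i j) (z₀ i j)) :=
    fun i j => by
      have hμ := h.weight_pos i j
      rw [← hw0, ← h.weight_smul_of_isDualOpt hθs hw, ← smul_sub, real_inner_smul_right,
        ← mul_assoc, ← hcoef i j]
      change inner ℝ ((Q.L i j / Q.weight (.inr (i, j))) • z₀ i j) _ = _
      rw [real_inner_smul_left]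
      congr 1
      field_simp
  have hact : ∀ x : Fin n × Fin K → Vec d, ∀ e, act (pinvProj Q.incidenceComm) x e
      = ∑ e', commProj e e' • x e' := fun x e =>
    Finset.sum_congr rfl fun e' _ => by rw [Q.pinvProj_incidenceComm h.n_pos h.one_le_K]
  have hx0 : ∑ e : Fin n × Fin K, inner ℝ (Q.refGradInit z₀ (.inl e))
      (w (.inl e) - Q.dualInit z₀ (.inl e)) = 0 :=
    Finset.sum_eq_zero fun e _ => inner_zero_left _
  have hx1 : ∑ e : Fin n × Fin K, inner ℝ (Q.dualInit z₀ (.inl e))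
      (act (pinvProj Q.incidenceComm) (fun e' => Q.dualInit z₀ (.inl e')) e) = 0 :=
    Finset.sum_eq_zero fun e _ => inner_zero_left _
  have hx2 : ∑ e : Fin n × Fin K, inner ℝ (w (.inl e))
      (act (pinvProj Q.incidenceComm) (fun e' => w (.inl e')) e)
      = energy (Q.nodeRes θs (Q.init z₀)) (Q.tokenRes θs (Q.init z₀)) := by
    simp only [hact]
    refine (sum_inner_commProj fun e => w (.inl e)).trans ?_
    simp only [h.sum_inl_of_isDualOpt hθs hw z₀, h.sum_inr_of_isDualOpt hθs hw z₀]
    simp [energy]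
  unfold bregman refFun
  rw [Fintype.sum_sum_type, hx0, hx1, hx2, Fintype.sum_prod_type]
  simp only [hw0, h.weight_smul_of_isDualOpt hθs hw, hcoef, hlin,
    conj_gradient (h.convex _ _) (h.diff _ _), EReal.toReal_coe, ← Finset.mul_sum]
  have hD : ∑ i, ∑ j, bregDiv (Q.f i j) (z₀ i j) θs
      = ∑ i, ∑ j, (inner ℝ (gradient (Q.f i j) θs) θs - Q.f i j θs)
        - ∑ i, ∑ j, (inner ℝ (gradient (Q.f i j) (z₀ i j)) (z₀ i j) - Q.f i j (z₀ i j))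
        - ∑ i, ∑ j, inner ℝ (z₀ i j) (gradient (Q.f i j) θs - gradient (Q.f i j) (z₀ i j)) := by
    simp only [← Finset.sum_sub_distrib]
    refine Finset.sum_congr rfl fun i _ => Finset.sum_congr rfl fun j _ => ?_
    rw [bregDiv, inner_sub_right, inner_sub_right, real_inner_comm (z₀ i j),
      real_inner_comm (gradient (Q.f i j) (z₀ i j)) (z₀ i j)]
    ring
  unfold refDiv
  simp only [init] at *
  rw [hD]
  ring

lemma dualObj_sub_eq (h : Q.Regular) (hθs : ∀ θ, Q.objective θs ≤ Q.objective θ)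
    (hw : Q.IsDualOpt w) (z₀ : Fin n → Fin m → Vec d) :
    (Q.dualObj (Q.dualInit z₀)).toReal - (Q.dualObj w).toReal = Q.dualGap θs (Q.init z₀) := by
  have hσ := h.sigmaT_pos
  have hw0 : ∀ i j, Q.weight (.inr (i, j)) • Q.dualInit z₀ (.inr (i, j))
      = gradient (Q.f i j) (z₀ i j) := fun i j => smul_inv_smul₀ (h.weight_pos i j).ne' _
  have h1 := h.dualQuad_add (Q.dualInit z₀) θs
  have h2 : ∑ v : Fin n ⊕ Fin K, ‖act Q.incidence (Q.dualInit z₀) (.inr v) - Q.sigmaT • θs‖ ^ 2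
      = Q.sigmaT ^ 2 * (Q.init z₀).sqDist θs := by
    rw [Fintype.sum_sum_type, State.sqDist, mul_add, Finset.mul_sum, Finset.mul_sum]
    have hn : ∀ x : Vec d, Q.sigmaT ^ 2 * ‖x‖ ^ 2 = ‖Q.sigmaT • x‖ ^ 2 := fun x => by
      rw [norm_smul, mul_pow, Real.norm_eq_abs, sq_abs]
    congr 1
    · refine Finset.sum_congr rfl fun i _ => ?_
      rw [hn, smul_sub, act_center]
      simp only [hw0]
      simp [dualInit, init, smul_smul, hσ.ne']
    · refine Finset.sum_congr rfl fun i _ => ?_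
      rw [hn, smul_sub, act_token]
      simp [dualInit, init]
  rw [Q.dualObj_eq _ h.convex h.diff z₀ hw0, h.dualObj_of_isDualOpt hθs hw, EReal.toReal_coe,
    EReal.toReal_coe]
  rw [h2] at h1
  simp only [act_comp, hw0] at h1 ⊢
  have hD : ∑ i, ∑ j, bregDiv (Q.f i j) θs (z₀ i j)
      = ∑ i, ∑ j, (inner ℝ (gradient (Q.f i j) (z₀ i j)) (z₀ i j) - Q.f i j (z₀ i j))
        - ∑ i, ∑ j, (inner ℝ (gradient (Q.f i j) (z₀ i j)) θs - Q.f i j θs) := by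
    simp only [← Finset.sum_sub_distrib]
    refine Finset.sum_congr rfl fun i _ => Finset.sum_congr rfl fun j _ => ?_
    rw [bregDiv, inner_sub_right]
    ring
  have h3 : 1 / (2 * Q.sigmaT) * (Q.sigmaT ^ 2 * (Q.init z₀).sqDist θs)
      = Q.sigmaT / 2 * (Q.init z₀).sqDist θs := by field_simp
  rw [h3] at h1
  unfold dualGap
  change _ = _ + ∑ i, ∑ j, bregDiv (Q.f i j) θs (z₀ i j)
  rw [hD]
  linarith

lemma lyapunovInit_eq (h : Q.Regular) (hθs : ∀ θ, Q.objective θs ≤ Q.objective θ)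
    (hw : Q.IsDualOpt w) (pcomp : ℝ) (z₀ : Fin n → Fin m → Vec d) :
    Q.lyapunovInit pcomp z₀ w = Q.lyapunov pcomp θs (Q.init z₀) := by
  rw [lyapunovInit, h.bregman_eq hθs hw, h.dualObj_sub_eq hθs hw, lyapunov]

end Problem.Regular

/-! ### Expectations of functions of finite random variables -/

section Probability

variable {Ω α β : Type*} [MeasurableSpace Ω] {P : Measure Ω} [IsProbabilityMeasure P]

lemma integrable_comp_of_finite [Finite β] [MeasurableSpace β] [MeasurableSingletonClass β]
    {Y : Ω → β} (hY : Measurable Y) (F : β → ℝ) : Integrable (fun ω => F (Y ω)) P := by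
  have := Measure.isProbabilityMeasure_map (μ := P) hY.aemeasurable
  exact (Integrable.of_finite (μ := P.map Y) (f := F)).comp_measurable hY

/-- The expectation of a function of two independent finite random variables. -/
lemma integral_indepFun_finite [Fintype α] [MeasurableSpace α] [MeasurableSingletonClass α]
    [Finite β] [MeasurableSpace β] [MeasurableSingletonClass β] {X : Ω → α} {Y : Ω → β}
    (hX : Measurable X) (hY : Measurable Y) (hXY : IndepFun X Y P) (F : α → β → ℝ) :
    ∫ ω, F (X ω) (Y ω) ∂P = ∑ a, P.real {ω | X ω = a} * ∫ ω, F a (Y ω) ∂P := by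
  classical
  have h1 : ∀ ω, F (X ω) (Y ω) = ∑ a, (if X ω = a then 1 else 0) * F a (Y ω) := by simp
  have h2 : ∀ a, ∫ ω, (if X ω = a then (1 : ℝ) else 0) * F a (Y ω) ∂P
      = P.real {ω | X ω = a} * ∫ ω, F a (Y ω) ∂P := fun a => by
    rw [hXY.integral_fun_comp_mul_comp (f := fun x => if x = a then (1 : ℝ) else 0) (g := F a)
      hX.aemeasurable hY.aemeasurable (measurable_of_finite _).aestronglyMeasurable
      (measurable_of_finite _).aestronglyMeasurable]
    congr 1
    have hs : MeasurableSet {ω | X ω = a} := hX (measurableSet_singleton a)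
    rw [← integral_indicator_one hs]
    rfl
  simp only [h1]
  rw [integral_finsetSum]
  · exact Finset.sum_congr rfl fun a _ => h2 a
  · intro a _
    exact integrable_comp_of_finite (hX.prodMk hY)
      (fun p : α × β => (if p.1 = a then 1 else 0) * F a p.2)

lemma integral_finite [Fintype α] [MeasurableSpace α] [MeasurableSingletonClass α] {X : Ω → α}
    (hX : Measurable X) (F : α → ℝ) :
    ∫ ω, F (X ω) ∂P = ∑ a, P.real {ω | X ω = a} * F a := by
  have h := integral_indepFun_finite hX (measurable_const (a := ())) (indepFun_const_right X ())
    (fun a _ => F a) (P := P)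
  simpa using h

end Probability

instance {n m K : ℕ} : DiscreteMeasurableSpace (Edge n m K) :=
  ⟨fun _ => measurableSet_sum_iff.2 ⟨.of_discrete, .of_discrete⟩⟩

/-! ### Random iterates and linear convergence -/

namespace Problem

variable {d n m K : ℕ} (Q : Problem d n m K) (pcomp : ℝ) (z₀ : Fin n → Fin m → Vec d)

lemma iterate_congr {ξ ξ' : ℕ → Edge n m K} :
    ∀ t, (∀ s < t, ξ s = ξ' s) → Q.iterate pcomp z₀ ξ t = Q.iterate pcomp z₀ ξ' t
  | 0, _ => rfl
  | t + 1, h => by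
    rw [iterate, iterate, h t (Nat.lt_succ_self t),
      iterate_congr t fun s hs => h s (hs.trans (Nat.lt_succ_self t))]

/-- The iterate is a function of the edges drawn so far. -/
lemma exists_iterate_eq [Nonempty (Edge n m K)] (t : ℕ) :
    ∃ G : (Finset.range t → Edge n m K) → State d n m K,
      ∀ ξ : ℕ → Edge n m K, Q.iterate pcomp z₀ ξ t = G fun i => ξ i := by
  classical
  refine ⟨fun y => Q.iterate pcomp z₀
    (fun s => if hs : s ∈ Finset.range t then y ⟨s, hs⟩ else Classical.arbitrary _) t, fun ξ => ?_⟩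
  refine Q.iterate_congr pcomp z₀ t fun s hs => ?_
  simp [hs]

lemma balanced_iterate {θs : Vec d} (hσ : Q.sigmaT ≠ 0) (h0 : Q.Balanced θs (Q.init z₀))
    (ξ : ℕ → Edge n m K) : ∀ t, Q.Balanced θs (Q.iterate pcomp z₀ ξ t)
  | 0 => h0
  | t + 1 => Q.balanced_step pcomp θs _ hσ _ (balanced_iterate hσ h0 ξ t)

section Random

variable {Ω : Type*} [MeasurableSpace Ω] {P : Measure Ω} [IsProbabilityMeasure P]
  {ξ : ℕ → Ω → Edge n m K}

/-- The iterate factors through finitely many finite-valued draws, so every real function of the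
state is integrable and no measurable structure on states is needed. -/
lemma integrable_iterate [Nonempty (Edge n m K)] (hξm : ∀ t, Measurable (ξ t)) (t : ℕ) (F : State d n m K → ℝ) :
    Integrable (fun ω => F (Q.iterate pcomp z₀ (fun s => ξ s ω) t)) P := by
  obtain ⟨G, hG⟩ := Q.exists_iterate_eq pcomp z₀ t
  simp only [hG]
  exact integrable_comp_of_finite (Y := fun ω (i : Finset.range t) => ξ i ω)
    (measurable_pi_lambda _ fun i => hξm i) (fun y => F (G y))

lemma integral_iterate_succ [Nonempty (Edge n m K)] (hξm : ∀ t, Measurable (ξ t))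
    (hξi : iIndepFun ξ P)
    (hξ : ∀ t e, P.real {ω | ξ t ω = e} = Q.prob pcomp e) (t : ℕ) (F : State d n m K → ℝ) :
    ∫ ω, F (Q.iterate pcomp z₀ (fun s => ξ s ω) (t + 1)) ∂P
      = ∫ ω, ∑ e, Q.prob pcomp e
          * F (Q.step pcomp e (Q.iterate pcomp z₀ (fun s => ξ s ω) t)) ∂P := by
  rw [integral_finsetSum _ fun e _ => (Q.integrable_iterate pcomp z₀ hξm t
    (fun s => F (Q.step pcomp e s))).const_mul _]
  simp only [integral_const_mul, iterate]
  obtain ⟨G, hG⟩ := Q.exists_iterate_eq pcomp z₀ t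
  simp only [hG, ← hξ t]
  -- The draw at time `t` is independent of the draws before `t`, which determine the current
  -- iterate.
  have hind := (hξi.indepFun_finset {t} (Finset.range t) (by simp) hξm).comp
    (φ := fun y : (({t} : Finset ℕ) → Edge n m K) => y ⟨t, Finset.mem_singleton_self t⟩) (ψ := id)
    (measurable_pi_apply (X := fun _ => Edge n m K)
      (⟨t, Finset.mem_singleton_self t⟩ : ({t} : Finset ℕ))) measurable_id
  exact integral_indepFun_finite (Y := fun ω (i : Finset.range t) => ξ i ω) (hξm t)
    (measurable_pi_lambda _ fun i => hξm i) hind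
    (fun e y => F (Q.step pcomp e (G y)))

lemma integral_sum_range (hξm : ∀ t, Measurable (ξ t))
    (hξ : ∀ t e, P.real {ω | ξ t ω = e} = Q.prob pcomp e)
    (F : Edge n m K → ℝ) (T : ℕ) :
    ∫ ω, ∑ s ∈ Finset.range T, F (ξ s ω) ∂P = T * ∑ e, Q.prob pcomp e * F e := by
  rw [integral_finsetSum _ fun s _ => integrable_comp_of_finite (hξm s) F]
  simp only [integral_finite (hξm _), hξ, Finset.sum_const, Finset.card_range, nsmul_eq_mul]

end Random

namespace Regular

variable {Q pcomp}
variable {Ω : Type*} [MeasurableSpace Ω] {P : Measure Ω} [IsProbabilityMeasure P]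
  {ξ : ℕ → Ω → Edge n m K}

lemma nonempty_edge (h : Q.Regular) : Nonempty (Edge n m K) :=
  ⟨.inl (⟨0, h.n_pos⟩, ⟨0, h.one_le_K⟩)⟩

lemma rate_pos (h : Q.Regular) (hp0 : 0 < pcomp) (hp1 : pcomp < 1) :
    0 < Q.eta pcomp * K / (Q.sigmaT * Q.kappaS) :=
  div_pos (mul_pos (h.eta_pos hp0 hp1) h.cast_K_pos) (mul_pos h.sigmaT_pos h.kappaS_pos)

lemma rate_eq (h : Q.Regular) :
    Q.eta pcomp * K / (Q.sigmaT * Q.kappaS) = min ((1 - pcomp) / (2 * n * Q.kappaS))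
      (pcomp / (2 * n * (m - 1 + Q.kappaS))) := by
  have h1 := h.cast_n_pos
  have h2 := h.cast_K_pos
  have h3 := h.sigmaT_pos
  have h4 := h.kappaS_pos
  have h5 := h.m_sub_one_add_kappaS_pos
  have h6 : 0 < K / (Q.sigmaT * Q.kappaS) := by positivity
  rw [mul_div_assoc, eta, min_mul_of_nonneg _ _ h6.le]
  congr 1
  · field_simp
  · unfold alpha
    field_simp

lemma rate_le_one (h : Q.Regular) (hp0 : 0 < pcomp) :
    Q.eta pcomp * K / (Q.sigmaT * Q.kappaS) ≤ 1 := by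
  have h1 : (1 : ℝ) ≤ n := Nat.one_le_cast.2 h.n_pos
  have h4 := h.one_le_kappaS
  rw [h.rate_eq]
  refine (min_le_left _ _).trans ?_
  rw [div_le_one (by positivity)]
  nlinarith

lemma integral_lyapunov_le (h : Q.Regular) {θs : Vec d}
    (hθs : ∀ θ, Q.objective θs ≤ Q.objective θ) (hp0 : 0 < pcomp) (hp1 : pcomp < 1)
    (hξm : ∀ t, Measurable (ξ t)) (hξi : iIndepFun ξ P)
    (hξ : ∀ t e, P.real {ω | ξ t ω = e} = Q.prob pcomp e) :
    ∀ t, ∫ ω, Q.lyapunov pcomp θs (Q.iterate pcomp z₀ (fun s => ξ s ω) t) ∂P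
      ≤ (1 - Q.eta pcomp * K / (Q.sigmaT * Q.kappaS)) ^ t * Q.lyapunov pcomp θs (Q.init z₀)
  | 0 => by simp [iterate]
  | t + 1 => by
    have := h.nonempty_edge
    rw [Q.integral_iterate_succ pcomp z₀ hξm hξi hξ t]
    have hr := sub_nonneg.2 (h.rate_le_one hp0 (pcomp := pcomp))
    calc _ ≤ ∫ ω, (1 - Q.eta pcomp * K / (Q.sigmaT * Q.kappaS)) *
          Q.lyapunov pcomp θs (Q.iterate pcomp z₀ (fun s => ξ s ω) t) ∂P := by
          refine integral_mono (Q.integrable_iterate pcomp z₀ hξm t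
            (fun s => ∑ e, Q.prob pcomp e * Q.lyapunov pcomp θs (Q.step pcomp e s)))
            ((Q.integrable_iterate pcomp z₀ hξm t _).const_mul _) fun ω => ?_
          exact h.sum_prob_mul_lyapunov_le_rate θs _ hp0 hp1
            (Q.balanced_iterate pcomp z₀ h.sigmaT_pos.ne' (h.balanced_init hθs z₀) _ t)
      _ ≤ _ := by
          rw [integral_const_mul, pow_succ', mul_assoc]
          exact mul_le_mul_of_nonneg_left
            (h.integral_lyapunov_le hθs hp0 hp1 hξm hξi hξ t) hr

lemma integral_sqDist_le (h : Q.Regular) {θs : Vec d}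
    (hθs : ∀ θ, Q.objective θs ≤ Q.objective θ) (hp0 : 0 < pcomp) (hp1 : pcomp < 1)
    (hξm : ∀ t, Measurable (ξ t)) (hξi : iIndepFun ξ P)
    (hξ : ∀ t e, P.real {ω | ξ t ω = e} = Q.prob pcomp e) {w : Edge n m K → Vec d}
    (hw : Q.IsDualOpt w) (t : ℕ) :
    ∫ ω, (Q.iterate pcomp z₀ (fun s => ξ s ω) t).sqDist θs ∂P
      ≤ (1 - Q.eta pcomp * K / (Q.sigmaT * Q.kappaS)) ^ t * Q.C0 pcomp z₀ w := by
  have := h.nonempty_edge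
  have hσ := h.sigmaT_pos
  have hη := h.eta_pos hp0 hp1
  have hR := h.Rp_pos hp0 hp1
  rw [C0, h.lyapunovInit_eq hθs hw, mul_left_comm]
  calc _ ≤ ∫ ω, 2 * Q.Rp pcomp / (Q.sigmaT * Q.eta pcomp) *
        Q.lyapunov pcomp θs (Q.iterate pcomp z₀ (fun s => ξ s ω) t) ∂P :=
        integral_mono (Q.integrable_iterate pcomp z₀ hξm t (fun s => s.sqDist θs))
          ((Q.integrable_iterate pcomp z₀ hξm t _).const_mul _)
          fun ω => h.sqDist_le_lyapunov θs _ hp0 hp1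
    _ ≤ _ := by
        rw [integral_const_mul]
        gcongr
        exact h.integral_lyapunov_le z₀ hθs hp0 hp1 hξm hξi hξ t

lemma C0_nonneg (h : Q.Regular) {θs : Vec d}
    (hθs : ∀ θ, Q.objective θs ≤ Q.objective θ) (hp0 : 0 < pcomp) (hp1 : pcomp < 1)
    {w : Edge n m K → Vec d} (hw : Q.IsDualOpt w) : 0 ≤ Q.C0 pcomp z₀ w := by
  rw [C0, h.lyapunovInit_eq hθs hw]
  refine le_trans ?_ (h.sqDist_le_lyapunov θs _ hp0 hp1)
  unfold State.sqDist
  positivity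

lemma integral_compCount (h : Q.Regular) (hξm : ∀ t, Measurable (ξ t))
    (hξ : ∀ t e, P.real {ω | ξ t ω = e} = Q.prob pcomp e) (i : Fin n) (T : ℕ) :
    ∫ ω, (compCount (fun s => ξ s ω) i T : ℝ) ∂P = T * (pcomp / n) := by
  classical
  have h4 := h.sum_one_add_L_div_pos i
  have h1 : ∀ ω, (compCount (fun s => ξ s ω) i T : ℝ)
      = ∑ s ∈ Finset.range T, if ∃ j, ξ s ω = .inr (i, j) then 1 else 0 := fun ω => by
    rw [compCount, Finset.card_filter]
    push_cast
    refine Finset.sum_congr rfl fun s _ => ?_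
    congr
  simp only [h1]
  rw [Q.integral_sum_range pcomp hξm hξ (fun e => if ∃ j, e = .inr (i, j) then 1 else 0)]
  congr 1
  rw [Fintype.sum_sum_type, Fintype.sum_prod_type, Fintype.sum_prod_type]
  have h2 : ∀ i', ∑ j, Q.prob pcomp (.inr (i', j)) *
      (if ∃ j', (Sum.inr (i', j) : Edge n m K) = .inr (i, j') then 1 else 0)
      = if i' = i then pcomp / n else 0 := fun i' => by
    by_cases hi : i' = i
    · subst hi
      simp only [Sum.inr.injEq, Prod.mk.injEq, true_and, exists_eq', if_true, mul_one, prob]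
      rw [← Finset.mul_sum, ← Finset.sum_div, div_self h4.ne', mul_one]
    · simp [hi]
  simp only [h2]
  simp

lemma integral_commCount (h : Q.Regular) (hξm : ∀ t, Measurable (ξ t))
    (hξ : ∀ t e, P.real {ω | ξ t ω = e} = Q.prob pcomp e) (T : ℕ) :
    ∫ ω, (commCount (fun s => ξ s ω) T : ℝ) ∂P = T * (1 - pcomp) := by
  classical
  have h1 := h.cast_n_pos
  have h2 := h.cast_K_pos
  have h3 : ∀ ω, (commCount (fun s => ξ s ω) T : ℝ)
      = ∑ s ∈ Finset.range T, if ∃ e, ξ s ω = .inl e then 1 else 0 := fun ω => by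
    rw [commCount, Finset.card_filter]
    push_cast
    refine Finset.sum_congr rfl fun s _ => ?_
    congr
  simp only [h3]
  rw [Q.integral_sum_range pcomp hξm hξ (fun e => if ∃ e', e = .inl e' then 1 else 0)]
  congr 1
  rw [Fintype.sum_sum_type]
  simp [prob]
  field_simp

end Regular

end Problem

/-- The number of steps that a linear rate needs to reach a given accuracy. -/
lemma exists_steps_of_linear_rate {u : ℕ → ℝ} {a C ε : ℝ} (ha0 : 0 < a) (ha1 : a ≤ 1)
    (hC : 0 ≤ C) (hu : ∀ t, u t ≤ (1 - a) ^ t * C) (hε : 0 < ε) :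
    ∃ T : ℕ, (∀ t, T ≤ t → u t ≤ ε) ∧ (T : ℝ) ≤ 1 + max 0 (Real.log (C / ε)) / a := by
  have hl : 0 ≤ max 0 (Real.log (C / ε)) / a := div_nonneg (le_max_left _ _) ha0.le
  refine ⟨⌈max 0 (Real.log (C / ε)) / a⌉₊, fun t ht => (hu t).trans ?_, ?_⟩
  -- For `C = 0` the logarithm takes its default value `0`, but then the bound on `u` is `0`.
  · rcases hC.eq_or_lt with rfl | hC
    · simpa using hε.le
    have h1 : max 0 (Real.log (C / ε)) ≤ t * a := (div_le_iff₀ ha0).1 (Nat.ceil_le.1 ht)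
    have h2 : (1 - a) ^ t ≤ Real.exp (-Real.log (C / ε)) := by
      calc (1 - a) ^ t ≤ Real.exp (-a) ^ t :=
            pow_le_pow_left₀ (sub_nonneg.2 ha1) (Real.one_sub_le_exp_neg a) t
        _ = Real.exp (-(t * a)) := by rw [← Real.exp_nat_mul]; ring_nf
        _ ≤ _ := Real.exp_le_exp.2 (neg_le_neg ((le_max_right _ _).trans h1))
    rw [Real.exp_neg, Real.exp_log (by positivity), inv_div] at h2
    calc (1 - a) ^ t * C ≤ ε / C * C := by gcongr
      _ = ε := div_mul_cancel₀ _ hC.ne'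
  · linarith [Nat.ceil_lt_add_one hl]

end TVR

end

/-! ### Counting gradient steps and token jumps -/

noncomputable section

namespace TVR.Problem.Regular

variable {d n m K : ℕ} {Q : Problem d n m K} {pcomp : ℝ}

/-- With `q` a probability of the form `2 M · rate`, the logarithmic part of `T` contributes `2 M
l`, and the extra step due to rounding contributes `q ≤ 1 ≤ 2 M`. -/
lemma steps_mul_le (h : Q.Regular) (hp0 : 0 < pcomp) (hp1 : pcomp < 1) {T l q M : ℝ} (hq : q ≤ 1)
    (hM : 1 ≤ M) (hT : T ≤ 1 + l / (Q.eta pcomp * K / (Q.sigmaT * Q.kappaS)))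
    (hqM : q = 2 * M * (Q.eta pcomp * K / (Q.sigmaT * Q.kappaS))) :
    T * q ≤ 2 * M * (1 + l) := by
  have ha := h.rate_pos hp0 hp1
  set a := Q.eta pcomp * K / (Q.sigmaT * Q.kappaS)
  have hq0 : 0 ≤ q := by rw [hqM]; positivity
  calc T * q ≤ (1 + l / a) * q := by gcongr
    _ = q + 2 * M * l := by
      rw [add_mul, one_mul]
      nth_rewrite 2 [hqM]
      field_simp
    _ ≤ _ := by linarith

lemma steps_mul_div_le (h : Q.Regular) (hp0 : 0 < pcomp) (hp1 : pcomp < 1) {T l : ℝ}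
    (hl : 0 ≤ l) (hT : T ≤ 1 + l / (Q.eta pcomp * K / (Q.sigmaT * Q.kappaS)))
    (hp : pcomp = 2 * (n * (m - 1 + Q.kappaS)) *
      (Q.eta pcomp * K / (Q.sigmaT * Q.kappaS))) :
    T * (pcomp / n) ≤ 2 * (m + Q.kappaS) * (1 + l) := by
  have hn := h.cast_n_pos
  have hn1 : (1 : ℝ) ≤ n := Nat.one_le_cast.2 h.n_pos
  have hm := h.one_le_cast_m
  have hκ := h.one_le_kappaS
  have h1 := h.steps_mul_le hp0 hp1 hp1.le (by nlinarith) hT hp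
  have h2 : T * pcomp / n ≤ 2 * (n * (m - 1 + Q.kappaS)) * (1 + l) / n := by gcongr
  calc T * (pcomp / n) = T * pcomp / n := by ring
    _ ≤ 2 * (n * (m - 1 + Q.kappaS)) * (1 + l) / n := h2
    _ = 2 * (m - 1 + Q.kappaS) * (1 + l) := by field_simp
    _ ≤ _ := by gcongr; linarith

end TVR.Problem.Regular

end

theorem mainTheorem6 {d n m K : ℕ} (hm : 1 ≤ m) (hK : 1 ≤ K) (hKn : K ≤ n)
    (Q : TVR.Problem d n m K) (hσ : 0 < Q.σ) (hL : ∀ i j, 0 < Q.L i j)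
    (hconv : ∀ i j, ConvexOn ℝ Set.univ (Q.f i j))
    (hdiff : ∀ i j, Differentiable ℝ (Q.f i j))
    (hsmooth : ∀ i j x y,
      ‖gradient (Q.f i j) x - gradient (Q.f i j) y‖ ≤ Q.L i j * ‖x - y‖)
    (θs : TVR.Vec d) (hθs : ∀ θ, Q.objective θs ≤ Q.objective θ)
    (pcomp : ℝ) (hp0 : 0 < pcomp) (hp1 : pcomp < 1)
    (z₀ : Fin n → Fin m → TVR.Vec d)
    {Ω : Type*} [MeasurableSpace Ω] (P : Measure Ω) [IsProbabilityMeasure P]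
    (ξ : ℕ → Ω → TVR.Edge n m K) (hξm : ∀ t, Measurable (ξ t)) (hξi : iIndepFun ξ P)
    (hξ : ∀ t e, P.real {ω | ξ t ω = e} = Q.prob pcomp e) :
    (∃ ws, Q.IsDualOpt ws) ∧
    ∀ ws, Q.IsDualOpt ws →
      (∀ t : ℕ,
        Integrable (fun ω => (Q.iterate pcomp z₀ (fun s => ξ s ω) t).sqDist θs) P ∧
        ∫ ω, (Q.iterate pcomp z₀ (fun s => ξ s ω) t).sqDist θs ∂P
          ≤ (1 - Q.eta pcomp * K / (Q.sigmaT * Q.kappaS)) ^ t * Q.C0 pcomp z₀ ws) ∧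
      (pcomp = Q.pBalanced → ∀ ε : ℝ, 0 < ε → ∃ T : ℕ,
        (∀ t, T ≤ t →
          ∫ ω, (Q.iterate pcomp z₀ (fun s => ξ s ω) t).sqDist θs ∂P ≤ ε) ∧
        (∀ i, ∫ ω, (TVR.compCount (fun s => ξ s ω) i T : ℝ) ∂P
          ≤ 2 * (m + Q.kappaS) * (1 + max 0 (Real.log (Q.C0 pcomp z₀ ws / ε)))) ∧
        ∫ ω, (TVR.commCount (fun s => ξ s ω) T : ℝ) ∂P
          ≤ 2 * (n * Q.kappaS) * (1 + max 0 (Real.log (Q.C0 pcomp z₀ ws / ε)))) ∧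
      (pcomp = 1 / 2 → ∀ ε : ℝ, 0 < ε → ∃ T : ℕ,
        (∀ t, T ≤ t →
          ∫ ω, (Q.iterate pcomp z₀ (fun s => ξ s ω) t).sqDist θs ∂P ≤ ε) ∧
        (∀ i, ∫ ω, (TVR.compCount (fun s => ξ s ω) i T : ℝ) ∂P
          ≤ 2 * (m + Q.kappaS) * (1 + max 0 (Real.log (Q.C0 pcomp z₀ ws / ε)))) ∧
        ∫ ω, (TVR.commCount (fun s => ξ s ω) T : ℝ) ∂P
          ≤ 2 * (n * (m - 1 + Q.kappaS)) * (1 + max 0 (Real.log (Q.C0 pcomp z₀ ws / ε)))) := by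
  have h : Q.Regular := ⟨hm, hK, hKn, hσ, hL, hconv, hdiff, hsmooth⟩
  have hne := h.nonempty_edge
  have hn : (1 : ℝ) ≤ n := Nat.one_le_cast.2 h.n_pos
  have hm' := h.one_le_cast_m
  have hκ := h.one_le_kappaS
  refine ⟨h.exists_isDualOpt hθs, fun ws hws => ?_⟩
  have hC := h.C0_nonneg z₀ hθs hp0 hp1 hws
  have hbound := h.integral_sqDist_le z₀ hθs hp0 hp1 hξm hξi hξ hws
  refine ⟨fun t => ⟨Q.integrable_iterate pcomp z₀ hξm t (fun s => s.sqDist θs), hbound t⟩,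
    fun hp ε hε => ?_, fun hp ε hε => ?_⟩
  · have hN := h.m_sub_one_add_kappaS_pos
    -- At the balanced `p_comp` the two arguments of the minimum in `rate_eq` coincide, so both
    -- probabilities are exact multiples of the rate.
    have hp1' : 1 - pcomp
        = 2 * (n * Q.kappaS) * (Q.eta pcomp * K / (Q.sigmaT * Q.kappaS)) := by
      rw [h.rate_eq, min_eq_left]
      · field_simp
      · rw [hp, TVR.Problem.pBalanced]
        apply le_of_eq
        field_simp
        ring
    have hp0' : pcomp = 2 * (n * (m - 1 + Q.kappaS)) *
        (Q.eta pcomp * K / (Q.sigmaT * Q.kappaS)) := by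
      rw [h.rate_eq, min_eq_right]
      · field_simp
      · rw [hp, TVR.Problem.pBalanced]
        apply le_of_eq
        field_simp
        ring
    obtain ⟨T, hT, hTle⟩ := TVR.exists_steps_of_linear_rate (h.rate_pos hp0 hp1)
      (h.rate_le_one hp0) hC hbound hε
    refine ⟨T, hT, fun i => ?_, ?_⟩
    · rw [h.integral_compCount hξm hξ]
      exact h.steps_mul_div_le hp0 hp1 (le_max_left _ _) hTle hp0'
    · rw [h.integral_commCount hξm hξ]
      exact h.steps_mul_le hp0 hp1 (by linarith) (by nlinarith) hTle hp1'
  · have hN := h.m_sub_one_add_kappaS_pos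
    -- With equal probabilities the computation constraint binds, since `κ_s ≤ m - 1 + κ_s`;
    -- communication then inherits the factor `m - 1 + κ_s`.
    have hp0' : pcomp = 2 * (n * (m - 1 + Q.kappaS)) *
        (Q.eta pcomp * K / (Q.sigmaT * Q.kappaS)) := by
      rw [h.rate_eq, min_eq_right]
      · field_simp
      · rw [show 1 - pcomp = pcomp by linarith]
        gcongr
        linarith
    obtain ⟨T, hT, hTle⟩ := TVR.exists_steps_of_linear_rate (h.rate_pos hp0 hp1)
      (h.rate_le_one hp0) hC hbound hε
    refine ⟨T, hT, fun i => ?_, ?_⟩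
    · rw [h.integral_compCount hξm hξ]
      exact h.steps_mul_div_le hp0 hp1 (le_max_left _ _) hTle hp0'
    · rw [h.integral_commCount hξm hξ, show 1 - pcomp = pcomp by linarith]
      exact h.steps_mul_le hp0 hp1 hp1.le (by nlinarith) hTle hp0'
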